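/- Let $l \ge 2$, and let $W = W(C_l^{(1)}) \cong W(D_{l+1}^{(2)})$ be the affine Weyl group with Coxeter generators $s_0, s_1, \dots, s_l$, where $(s_is_j)^2=1$ if $|i-j|\ge 2$, $(s_0s_1)^4=(s_{l-1}s_l)^4=1$, and $(s_is_{i+1})^3=1$ for $1\le i\le l-2$. Let $W_0=\langle s_1,\dots,s_l\rangle$; it is a finite Weyl group of type $C_l$, with $s_1,\dots,s_l$ as its standard generators. Let $E$ be the full heap over the Dynkin diagram of type $D_{l+1}^{(2)}$ whose elements are the pairs $(p,y)$ with $p\in\{0,\dots,l\}$, $y\in\mathbb Z$, $p\equiv y \pmod 2$, with label $\varepsilon(p,y)=p$ and order $(p,y)\le(p',y')$ iff $|p-p'|\le y'-y$. Let $\mathcal B$ be the set of its proper ideals, i.e. the order ideals $F$ such that $\emptyset\subsetneq F\cap\varepsilon^{-1}(p)\subsetneq\varepsilon^{-1}(p)$ for each $p$. Let $S_i:\mathcal B\to\mathcal B$ be the map which sends $I$ to the ideal obtained by removing an element labelled $i$, if this gives an ideal; otherwise to the ideal obtained by adding an element labelled $i$, if this gives an ideal; and otherwise to $I$. The group $W$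 acts on $\mathcal B$ by $s_i\cdot I=S_i(I)$. For $F\in\mathcal B$, the height $h(F)$ is the largest $t$ with $(0,2t)\in F$. Put $f(p)=1+\max\{y:(p,y)\in F\}$. The string of $F$ is the element of $\{+,-\}^l$ whose $i$-th symbol ($1\le i\le l$) is $+$ if $f(i)>f(i-1)$ and $-$ if $f(i)<f(i-1)$. Let $\phi$ be the automorphism $(p,y)\mapsto(p,y+2)$ of $E$. The map sending $F$ to $h(F)$ together with the string of $\phi^{-h(F)}(F)$ is a bijection $\mathcal B\to\mathbb Z\times\{+,-\}^l$; in particular, the ideals of height $0$ correspond to $\{+,-\}^l$. **Proposition 8.7.** The action of $W$ on $\mathcal B$ induces, through the ideals of height $0$ (which $W_0$ permutes), a transitive and faithful action of $W_0$ on $\{+,-\}^l$. For $1\le i<l$ the generator $s_i$ acts by exchanging the symbols at positions $i$ and $i+1$, and $s_l$ acts by altering the symbol at position $l$. This extends to a faithful action of $W$ on $\mathbb Z\times\{+,-\}^l$, namely the action induced from $\mathcal B$ by the bijection above. In it, every $w\in W_0$ acts as $(\mathrm{id},w)$, and $s_0$ acts as follows, where $\mathbf s'$ is obtained from $\mathbf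 s$ by deleting the first symbol: $$s_0((t,\,+\mathbf s'))=(t+1,\,-\mathbf s'),\qquad s_0((t,\,-\mathbf s'))=(t-1,\,+\mathbf s').$$ -/

import Mathlib

/-! ### Generalized Cartan matrices and Weyl groups -/

/-- The Coxeter matrix of a generalized Cartan matrix: the order of `s i * s j` for `i ≠ j` is
`2, 3, 4, 6` when `a i j * a j i = 0, 1, 2, 3`, and no relation is imposed otherwise
(the entry `0` of a Coxeter matrix means "no relation"). -/
def weylMatrix {P : Type*} [DecidableEq P] (A : Matrix P P ℤ) : CoxeterMatrix P where
  M := Matrix.of fun i j =>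
    if i = j then 1
    else if A i j * A j i = 0 then 2
    else if A i j * A j i = 1 then 3
    else if A i j * A j i = 2 then 4
    else if A i j * A j i = 3 then 6
    else 0
  isSymm := by
    ext i j
    simp only [Matrix.transpose_apply, Matrix.of_apply, mul_comm (A j i), eq_comm (a := j)]
  diagonal := by simp
  off_diagonal := by
    intro i j h
    simp only [Matrix.of_apply, if_neg h]
    split_ifs <;> norm_num

/-- A generalized Cartan matrix and its transpose have the same Weyl group. -/
theorem weylMatrix_transpose {P : Type*} [DecidableEq P] (A : Matrix P P ℤ) :
    weylMatrix A.transpose = weylMatrix A := by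
  ext i j
  simp only [weylMatrix, Matrix.transpose_apply, Matrix.of_apply, mul_comm (A j i)]

/-- The Weyl group of a generalized Cartan matrix, as a Coxeter group given by generators and
relations. Its generators are `(weylMatrix A).simple i`. -/
abbrev WeylGroup {P : Type*} [DecidableEq P] (A : Matrix P P ℤ) : Type _ :=
  (weylMatrix A).Group

/-- The generator `s i` of the Weyl group. -/
abbrev weylGen {P : Type*} [DecidableEq P] (A : Matrix P P ℤ) (i : P) : WeylGroup A :=
  (weylMatrix A).simple i

/-- The generalized Cartan matrix of affine type `D_{l+1}^{(2)}` (for `l ≥ 2`) on the vertices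
`0, 1, …, l`: a path, whose first and last edges are double, with arrows pointing towards the
end vertices `0` and `l`. -/
def cartanTwistedD (l : ℕ) : Matrix (Fin (l + 1)) (Fin (l + 1)) ℤ :=
  Matrix.of fun i j =>
    if i = j then 2
    else if i.val + 1 = j.val ∨ j.val + 1 = i.val then
      if i = 0 ∨ i = Fin.last l then -2 else -1
    else 0

/-- The generalized Cartan matrix of affine type `C_l^{(1)}` (for `l ≥ 2`): the same diagram with
the two arrows reversed. -/
def cartanAffineC (l : ℕ) : Matrix (Fin (l + 1)) (Fin (l + 1)) ℤ :=
  (cartanTwistedD l).transpose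

/-- The subgroup `W₀` of the Weyl group of type `C_l^{(1)}` generated by the `s i` with `i ≠ 0`. -/
def finiteWeyl (l : ℕ) : Subgroup (WeylGroup (cartanAffineC l)) :=
  Subgroup.closure {w | ∃ i : Fin (l + 1), i ≠ 0 ∧ w = weylGen (cartanAffineC l) i}

/-- The generator `s (j + 1)` as an element of `W₀`, for `0 ≤ j < l`. -/
def finiteGen (l : ℕ) (j : Fin l) : finiteWeyl l :=
  ⟨weylGen (cartanAffineC l) j.succ, Subgroup.subset_closure ⟨j.succ, Fin.succ_ne_zero j, rfl⟩⟩

/-! ### Heaps over a Dynkin diagram, given by its generalized Cartan matrix -/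

/-- Labelled heaps: locally finite posets with a labelling by the vertices, such that elements with
equal or adjacent labels are comparable, and the order is the transitive closure of its
restriction to pairs with equal or adjacent labels. (As `A p p = 2`, the vertices `p` and `q` are
equal or adjacent exactly if `A p q ≠ 0`.) -/
structure IsLabelledHeap {P E : Type*} [PartialOrder E] (A : Matrix P P ℤ) (ε : E → P) :
    Prop where
  finite_Icc : ∀ a b : E, (Set.Icc a b).Finite
  comparable : ∀ a b : E, A (ε a) (ε b) ≠ 0 → a ≤ b ∨ b ≤ a
  le_iff : ∀ a b : E,
    a ≤ b ↔ Relation.TransGen (fun x y : E => x ≤ y ∧ A (ε x) (ε y) ≠ 0) a b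

/-- Full heaps. The first four fields say that the labelled heap is fibred, the last one that the
labels strictly between two consecutive elements with label `p` satisfy the sum condition. -/
structure IsFullHeap {P E : Type*} [PartialOrder E] (A : Matrix P P ℤ) (ε : E → P) : Prop
    extends IsLabelledHeap A ε where
  nonempty_fibre : ∀ p : P, (ε ⁻¹' {p}).Nonempty
  exists_gt : ∀ a : E, ∃ b, ε b = ε a ∧ a < b
  exists_lt : ∀ a : E, ∃ b, ε b = ε a ∧ b < a
  exists_cover : ∀ (a : E) (q : P), q ≠ ε a → A (ε a) q ≠ 0 →
    ∃ b, ε b = q ∧ (a ⋖ b ∨ b ⋖ a)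
  sum_Ioo : ∀ a b : E, a < b → ε a = ε b → (∀ c ∈ Set.Ioo a b, ε c ≠ ε a) →
    ∑ᶠ c ∈ Set.Ioo a b, A (ε a) (ε c) = -2

/-- Proper ideals: order ideals `F` with `∅ ⊊ F ⊊ E` such that
`∅ ⊊ F ∩ ε⁻¹(p) ⊊ ε⁻¹(p)` for every vertex `p`. -/
structure IsProperIdeal {P E : Type*} [PartialOrder E] (ε : E → P) (F : Set E) : Prop where
  isLowerSet : IsLowerSet F
  empty_ssubset : ∅ ⊂ F
  ssubset_univ : F ⊂ Set.univ
  fibre : ∀ p : P, ∅ ⊂ F ∩ ε ⁻¹' {p} ∧ F ∩ ε ⁻¹' {p} ⊂ ε ⁻¹' {p}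

/-- The set of proper ideals. -/
def ProperIdeal {P E : Type*} [PartialOrder E] (ε : E → P) : Type _ :=
  {F : Set E // IsProperIdeal ε F}

/-- The elements with label `p` that can be removed from the ideal `I` (there is at most one). -/
def removable {P E : Type*} [PartialOrder E] (ε : E → P) (p : P) (I : Set E) : Set E :=
  {x | ε x = p ∧ x ∈ I ∧ IsLowerSet (I \ {x})}

/-- The elements with label `p` that can be added to the ideal `I` (there is at most one). -/
def addable {P E : Type*} [PartialOrder E] (ε : E → P) (p : P) (I : Set E) : Set E :=
  {x | ε x = p ∧ x ∉ I ∧ IsLowerSet (I ∪ {x})}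

open Classical in
/-- The operator `S p` on ideals: it removes the element with label `p` that can be removed,
if there is one; otherwise it adds the element with label `p` that can be added, if there is one;
otherwise it does nothing. -/
noncomputable def heapReflection {P E : Type*} [PartialOrder E] (ε : E → P) (p : P)
    (I : Set E) : Set E :=
  if (removable ε p I).Nonempty then I \ removable ε p I else I ∪ addable ε p I

theorem removable_subsingleton {P E : Type*} [PartialOrder E] {A : Matrix P P ℤ} {ε : E → P}
    (hE : IsLabelledHeap A ε) {p : P} (hp : A p p = 2) (I : Set E) :
    (removable ε p I).Subsingleton := by
  rintro x ⟨hx, hxI, hxl⟩ y ⟨hy, hyI, hyl⟩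
  by_contra hne
  rcases hE.comparable x y (by rw [hx, hy, hp]; norm_num) with h | h
  · exact (hxl h ⟨hyI, fun e => hne e.symm⟩).2 rfl
  · exact (hyl h ⟨hxI, fun e => hne e⟩).2 rfl

theorem addable_subsingleton {P E : Type*} [PartialOrder E] {A : Matrix P P ℤ} {ε : E → P}
    (hE : IsLabelledHeap A ε) {p : P} (hp : A p p = 2) (I : Set E) :
    (addable ε p I).Subsingleton := by
  rintro x ⟨hx, hxI, hxl⟩ y ⟨hy, hyI, hyl⟩
  by_contra hne
  rcases hE.comparable x y (by rw [hx, hy, hp]; norm_num) with h | h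
  · rcases hyl h (Or.inr rfl) with h' | h'
    exacts [hxI h', hne h']
  · rcases hxl h (Or.inr rfl) with h' | h'
    exacts [hyI h', hne h'.symm]

/-! ### The full heap over the diagram of type `D_{l+1}^{(2)}` -/

/-- Elements of the heap: the layer numbered `layer` consists of one element for each
vertex in `{0, …, l}` of the same parity as `layer`. -/
@[ext]
structure BinaryHeap (l : ℕ) where
  label : Fin (l + 1)
  layer : ℤ
  parity : (2 : ℤ) ∣ layer - (label.val : ℤ)

/-- The order: `a ≤ b` when `b` is reached from `a` by going up layer by layer, moving to an
adjacent label at each step. -/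
instance (l : ℕ) : PartialOrder (BinaryHeap l) where
  le a b := |(a.label.val : ℤ) - (b.label.val : ℤ)| ≤ b.layer - a.layer
  le_refl a := by simp
  le_trans a b c h₁ h₂ := by
    rw [abs_le] at *
    constructor <;> linarith [h₁.1, h₁.2, h₂.1, h₂.2]
  le_antisymm a b h₁ h₂ := by
    rw [abs_le] at *
    have h : (a.label.val : ℤ) = b.label.val := by linarith [h₁.1, h₁.2, h₂.1, h₂.2]
    ext
    · exact_mod_cast h
    · linarith [h₁.1, h₁.2, h₂.1, h₂.2]

namespace BinaryHeap

theorem le_def {l : ℕ} {a b : BinaryHeap l} :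
    a ≤ b ↔ |(a.label.val : ℤ) - (b.label.val : ℤ)| ≤ b.layer - a.layer := Iff.rfl

/-- The element `E(0, t)` of the chain of elements with label `0`. -/
def zeroElt (l : ℕ) (t : ℤ) : BinaryHeap l := ⟨0, 2 * t, by simp⟩

/-- The power `φ ^ k` of the fundamental automorphism, which raises every element by two layers. -/
def shift {l : ℕ} (k : ℤ) (a : BinaryHeap l) : BinaryHeap l :=
  ⟨a.label, a.layer + 2 * k, by
    have := a.parity
    omega⟩

/-- The height of a proper ideal: the largest `t` with `E(0, t)` in the ideal. -/
noncomputable def height {l : ℕ} (F : Set (BinaryHeap l)) : ℤ :=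
  sSup {t : ℤ | zeroElt l t ∈ F}

/-- The binary path of a proper ideal: one more than the largest layer in which the vertex `p`
occurs in the ideal. -/
noncomputable def path {l : ℕ} (F : Set (BinaryHeap l)) (p : Fin (l + 1)) : ℤ :=
  sSup {y : ℤ | ∃ a ∈ F, a.label = p ∧ a.layer = y} + 1

end BinaryHeap

/-- Strings of length `l` in the symbols `+` (`true`) and `-` (`false`). The symbol at position
`i`, where `1 ≤ i ≤ l`, is the value at the element `i - 1` of `Fin l`. -/
abbrev SignString (l : ℕ) : Type := Fin l → Bool

namespace BinaryHeap

/-- The string of a proper ideal: the symbol at position `i` is `+` if the binary path goes up from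
`i - 1` to `i`, and `-` otherwise. -/
noncomputable def signString {l : ℕ} (F : Set (BinaryHeap l)) : SignString l :=
  fun i => decide (path F i.castSucc < path F i.succ)

/-- The parametrization of proper ideals by pairs `(t, s)`: here `t` is the height of the ideal
`F`, and `s` is the string of the ideal `φ ^ (-t) F` of height `0`. -/
noncomputable def coords {l : ℕ} (F : Set (BinaryHeap l)) : ℤ × SignString l :=
  (height F, signString (shift (-height F) '' F))

end BinaryHeap

namespace BinaryHeap
/-- Elements in consecutive layers with adjacent labels form a covering pair, so the heap is ranked
by its layers. -/
theorem covBy_of {l : ℕ} {a b : BinaryHeap l}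
    (h : |(a.label.val : ℤ) - (b.label.val : ℤ)| = 1) (h' : b.layer = a.layer + 1) : a ⋖ b := by
  refine ⟨lt_of_le_of_ne ?_ ?_, ?_⟩
  · rw [le_def]; omega
  · rintro rfl; omega
  · intro c hac hcb
    have h1 := le_def.1 hac.le
    have h2 := le_def.1 hcb.le
    have h3 := abs_le.1 h1
    have h4 := abs_le.1 h2
    have h5 : a ≠ c := hac.ne
    have h6 : c ≠ b := hcb.ne
    by_cases e : c.layer = a.layer
    · apply h5; ext
      · have := h3; omega
      · omega
    · apply h6; ext
      · omega
      · omega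

/-- The heap is a full heap over the Dynkin diagram of type `D_{l+1}^{(2)}`. -/
theorem isFullHeap {l : ℕ} (hl : 2 ≤ l) :
    IsFullHeap (cartanTwistedD l) (label : BinaryHeap l → Fin (l + 1)) := by
  have hA : ∀ i j : Fin (l + 1), cartanTwistedD l i j ≠ 0 ↔ |(i.val : ℤ) - j.val| ≤ 1 := by
    intro i j
    have : i = j ↔ i.val = j.val := Fin.ext_iff
    simp only [cartanTwistedD, Matrix.of_apply, abs_le]
    split_ifs <;> simp <;> omega
  have hA1 : ∀ i j : Fin (l + 1), (i.val = 0 ∨ i.val = l) → (i.val + 1 = j.val ∨ j.val + 1 = i.val) →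
      cartanTwistedD l i j = -2 := by
    intro i j h h'
    have e : ¬ i = j := by rw [Fin.ext_iff]; omega
    have e' : i = 0 ∨ i = Fin.last l := h.imp (fun h => Fin.ext h) (fun h => Fin.ext h)
    simp only [cartanTwistedD, Matrix.of_apply, if_neg e, if_pos h', if_pos e']
  have hA2 : ∀ i j : Fin (l + 1), i.val ≠ 0 → i.val ≠ l → (i.val + 1 = j.val ∨ j.val + 1 = i.val) →
      cartanTwistedD l i j = -1 := by
    intro i j h0 h1 h'
    have e : ¬ i = j := by rw [Fin.ext_iff]; omega
    have e' : ¬ (i = 0 ∨ i = Fin.last l) := by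
      rintro (h | h)
      · exact h0 (by simp [h])
      · exact h1 (by simp [h])
    simp only [cartanTwistedD, Matrix.of_apply, if_neg e, if_pos h', if_neg e']
  have step : ∀ (n : ℕ) (a b : BinaryHeap l), a ≤ b → b.layer - a.layer = n →
      Relation.TransGen (fun x y : BinaryHeap l =>
        x ≤ y ∧ cartanTwistedD l x.label y.label ≠ 0) a b := by
    intro n
    induction n with
    | zero =>
      intro a b hab hn
      have := abs_le.1 (le_def.1 hab)
      refine .single ⟨hab, (hA _ _).2 ?_⟩
      rw [abs_le]; omega
    | succ n ih =>
      intro a b hab hn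
      have h1 := abs_le.1 (le_def.1 hab)
      have pa := a.parity
      have pb := b.parity
      have la := a.label.isLt
      have lb := b.label.isLt
      obtain ⟨q, hq1, hq2⟩ : ∃ q : Fin (l + 1), |(a.label.val : ℤ) - q.val| = 1 ∧
          |(q.val : ℤ) - b.label.val| ≤ n := by
        by_cases h : (a.label.val : ℤ) < b.label.val
        · refine ⟨⟨a.label.val + 1, by omega⟩, ?_, ?_⟩ <;> push_cast <;> 
            simp only [abs_eq, abs_le, zero_le_one] <;> omega
        · by_cases h' : (b.label.val : ℤ) < a.label.val
          · refine ⟨⟨a.label.val - 1, by omega⟩, ?_, ?_⟩ <;> push_cast <;> 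
            simp only [abs_eq, abs_le, zero_le_one] <;> omega
          · by_cases h0 : a.label.val = 0
            · refine ⟨⟨a.label.val + 1, by omega⟩, ?_, ?_⟩ <;> push_cast <;> 
                simp only [abs_eq, abs_le, zero_le_one] <;> omega
            · refine ⟨⟨a.label.val - 1, by omega⟩, ?_, ?_⟩ <;> push_cast <;> 
                simp only [abs_eq, abs_le, zero_le_one] <;> omega
      have hq3 : (2 : ℤ) ∣ (a.layer + 1) - q.val := by
        rcases (abs_eq (zero_le_one)).1 hq1 with h | h <;> omega
      let c : BinaryHeap l := ⟨q, a.layer + 1, hq3⟩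
      refine .trans (b := c) (.single ⟨(covBy_of hq1 rfl).le, (hA _ _).2 hq1.le⟩) (ih c b ?_ ?_)
      · rw [le_def]; simp only [c]; omega
      · simp only [c]; omega
  refine { finite_Icc := ?_, comparable := ?_, le_iff := ?_, nonempty_fibre := ?_,
           exists_gt := ?_, exists_lt := ?_, exists_cover := ?_, sum_Ioo := ?_ }
  · intro a b
    have hinj : Function.Injective (fun c : BinaryHeap l => (c.label, c.layer)) := by
      intro x y h
      simp only [Prod.mk.injEq] at h
      exact BinaryHeap.ext h.1 h.2
    refine Set.Finite.of_finite_image (f := fun c : BinaryHeap l => (c.label, c.layer)) ?_ hinj.injOn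
    refine (Set.Finite.prod Set.finite_univ (Set.finite_Icc a.layer b.layer)).subset ?_
    rintro _ ⟨c, ⟨h1, h2⟩, rfl⟩
    have h1 := abs_le.1 (le_def.1 h1)
    have h2 := abs_le.1 (le_def.1 h2)
    simp; omega
  · intro a b h
    have h := abs_le.1 ((hA _ _).1 h)
    have pa := a.parity
    have pb := b.parity
    rw [le_def, le_def, abs_le, abs_le]
    by_cases e : a.layer = b.layer <;> omega
  · intro a b
    constructor
    · intro h
      have h1 := abs_le.1 (le_def.1 h)
      exact step (b.layer - a.layer).toNat a b h (by omega)
    · intro h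
      induction h with
      | single h => exact h.1
      | tail _ h ih => exact ih.trans h.1
  · intro p
    exact ⟨⟨p, p.val, by simp⟩, rfl⟩
  · intro a
    have hc : a ≤ shift 1 a := by rw [le_def]; simp [shift]
    refine ⟨shift 1 a, rfl, lt_of_le_of_ne hc ?_⟩
    intro h; have := congrArg layer h; simp [shift] at this
  · intro a
    have hc : shift (-1) a ≤ a := by rw [le_def]; simp [shift]
    refine ⟨shift (-1) a, rfl, lt_of_le_of_ne hc ?_⟩
    intro h; have := congrArg layer h; simp [shift] at this
  · intro a q hq hAq
    have h := abs_le.1 ((hA _ _).1 hAq)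
    have hne : q.val ≠ a.label.val := fun e => hq (Fin.ext e)
    have pa := a.parity
    refine ⟨⟨q, a.layer + 1, by omega⟩, rfl, Or.inl (covBy_of ?_ rfl)⟩
    rw [abs_eq zero_le_one]; simp only; omega
  · intro a b hab hlab hno
    have pa := a.parity
    have pb := b.parity
    have h1 := abs_le.1 (le_def.1 hab.le)
    have hlab' : (a.label.val : ℤ) = b.label.val := by rw [hlab]
    have hne : a.layer ≠ b.layer := fun e => hab.ne (BinaryHeap.ext hlab e)
    have hb : b.layer = a.layer + 2 := by
      by_contra hcon
      have h2 : a ≤ shift 1 a := by rw [le_def]; simp [shift]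
      have h3 : shift 1 a ≤ b := by
        rw [le_def]; simp only [shift]; rw [abs_le]; omega
      refine hno (shift 1 a) ⟨lt_of_le_of_ne h2 ?_, lt_of_le_of_ne h3 ?_⟩ rfl
      · intro h; have := congrArg layer h; simp [shift] at this
      · intro h; have := congrArg layer h; simp [shift] at this; omega
    have hIoo : Set.Ioo a b = {c | c.layer = a.layer + 1 ∧ |(a.label.val : ℤ) - c.label.val| = 1} := by
      ext c
      constructor
      · rintro ⟨hac, hcb⟩
        have h3 := abs_le.1 (le_def.1 hac.le)
        have h4 := abs_le.1 (le_def.1 hcb.le)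
        have h5 : c.label ≠ a.label := hno c ⟨hac, hcb⟩
        have h6 : c.label.val ≠ a.label.val := fun e => h5 (Fin.ext e)
        have pc := c.parity
        simp only [Set.mem_ofPred_eq, abs_eq zero_le_one]
        omega
      · rintro ⟨h3, h4⟩
        exact ⟨(covBy_of h4 h3).lt, (covBy_of (by rw [abs_sub_comm, ← hlab']; exact h4) (by omega)).lt⟩
    rw [hIoo]
    have la := a.label.isLt
    by_cases h0 : a.label.val = 0
    · let c : BinaryHeap l := ⟨⟨1, by omega⟩, a.layer + 1, by simp only; omega⟩
      have : {c : BinaryHeap l | c.layer = a.layer + 1 ∧ |(a.label.val : ℤ) - c.label.val| = 1} = {c} := by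
        ext d
        simp only [Set.mem_ofPred_eq, abs_eq zero_le_one, Set.mem_singleton_iff, BinaryHeap.ext_iff, c,
          Fin.ext_iff]
        omega
      rw [this, finsum_mem_singleton]
      exact hA1 _ _ (Or.inl h0) (by simp only [c]; omega)
    · by_cases hL : a.label.val = l
      · let c : BinaryHeap l := ⟨⟨l - 1, by omega⟩, a.layer + 1, by simp only; omega⟩
        have : {c : BinaryHeap l | c.layer = a.layer + 1 ∧ |(a.label.val : ℤ) - c.label.val| = 1} = {c} := by
          ext d
          have ld := d.label.isLt
          simp only [Set.mem_ofPred_eq, abs_eq zero_le_one, Set.mem_singleton_iff, BinaryHeap.ext_iff, c,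
            Fin.ext_iff]
          omega
        rw [this, finsum_mem_singleton]
        exact hA1 _ _ (Or.inr hL) (by simp only [c]; omega)
      · let c : BinaryHeap l := ⟨⟨a.label.val - 1, by omega⟩, a.layer + 1, by simp only; omega⟩
        let d : BinaryHeap l := ⟨⟨a.label.val + 1, by omega⟩, a.layer + 1, by simp only; omega⟩
        have hcd : c ≠ d := by
          simp only [ne_eq, BinaryHeap.ext_iff, Fin.ext_iff, c, d]; omega
        have : {c : BinaryHeap l | c.layer = a.layer + 1 ∧ |(a.label.val : ℤ) - c.label.val| = 1} = {c, d} := by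
          ext e
          simp only [Set.mem_ofPred_eq, abs_eq zero_le_one, Set.mem_singleton_iff, Set.mem_insert_iff,
            BinaryHeap.ext_iff, c, d, Fin.ext_iff]
          omega
        rw [this, finsum_mem_pair hcd]
        rw [hA2 a.label c.label h0 hL (by simp only [c]; omega),
          hA2 a.label d.label h0 hL (Or.inl rfl)]
        norm_num

end BinaryHeap

/-! A proper ideal is the region below a lattice path with steps ±1, and such a path is an odd
starting value `2 t + 1` together with a sign string. Removing or adding an element labelled `i`
pushes down a strict local maximum or lifts a strict local minimum at `i`. In the interior this
exchanges two unequal adjacent signs; at the right end it alters the last sign; at the left end it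
alters the first sign and moves `t` by one. So the heap operators become explicit maps on pairs `(t,
s)` (`heapReflection_pathIdeal`). The Coxeter relations are checked for these maps, and the
resulting action is carried back to ideals along `properIdealEquiv`.

The substance is faithfulness, since the groups are given only by presentations. Number the
generators backwards: `b 0` is `s_l`, the sign change, and `b n` is `s_1`, where `n = l - 1`. In
type B, the suffixes of `b n … b 0 … b n` represent the cosets of the parabolic subgroup one rank
lower (`IsTypeBSequence.mul_cosetRep`). A nontrivial suffix visibly moves coordinate `n` or changes
its sign, so induction on the rank gives `ActsOnCoords.eq_one`. Applied to the presented group of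
type `C_l`, this also identifies that group with `W₀`.

In the affine case, multiply `s_0` by the element of `W₀` that flips the same coordinate. The
product fixes all signs and moves the level by ±1. Its `W₀`-conjugates commute and generate a
normalized subgroup `T`, and `W = T W₀`. An element acting trivially has trivial `W₀`-part by the
type B result. Its translation part is a product of powers whose exponents have signed sum zero for
every choice of signs, so every exponent vanishes (`ActsAffinely.eq_one_of_affine`). -/

/-! ### Sequences satisfying the relations of type `B` -/

/-- The elements `b 0, …, b (l - 1)` satisfy the Coxeter relations of type `B_l`, where the edge
between `0` and `1` is the double one. -/
structure IsTypeBSequence {G : Type*} [Group G] (b : ℕ → G) (l : ℕ) : Prop where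
  sq : ∀ i, i < l → b i * b i = 1
  comm : ∀ i j, i + 1 < j → j < l → b i * b j = b j * b i
  braid : ∀ i, i + 2 < l →
    b (i + 1) * b (i + 2) * b (i + 1) = b (i + 2) * b (i + 1) * b (i + 2)
  braid_zero : 1 < l → b 0 * b 1 * b 0 * b 1 = b 1 * b 0 * b 1 * b 0

/-- The suffixes of length `k` of the word `b n, …, b 1, b 0, b 1, …, b n`. For `k < 2 n + 2` they
represent the left cosets of the subgroup generated by `b 0, …, b (n - 1)`. -/
def cosetRep {G : Type*} [Group G] (b : ℕ → G) (n : ℕ) : ℕ → G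
  | 0 => 1
  | k + 1 => b ((n - k) + (k - n)) * cosetRep b n k

/-! ### Coset words and how generators slide through them. -/

section cosetRep

variable {G : Type*} [Group G] {b : ℕ → G} {l n : ℕ}

theorem cosetRep_succ_of_eq {k i : ℕ} (h : (n - k) + (k - n) = i) :
    cosetRep b n (k + 1) = b i * cosetRep b n k := by
  rw [cosetRep, h]

/-- The recursion defining the words adds letters on the left; this peels off the rightmost letter
instead. It works because the letter index, the truncated form of `|n - k|`, is unchanged when both
arguments increase by one. -/
theorem cosetRep_succ_succ (k : ℕ) :
    cosetRep b (n + 1) (k + 1) = cosetRep b n k * b (n + 1) := by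
  induction k with
  | zero => simp [cosetRep]
  | succ k ih =>
    rw [cosetRep, ih, cosetRep_succ_of_eq (k := k) rfl, mul_assoc]
    congr 2; omega

theorem cosetRep_mem (k : ℕ) (hk : k ≤ 2 * n + 1) :
    cosetRep b n k ∈ Subgroup.closure (b '' Set.Iio (n + 1)) := by
  induction k with
  | zero => exact one_mem _
  | succ k ih =>
    exact mul_mem (Subgroup.subset_closure ⟨_, by simp only [Set.mem_Iio]; omega, rfl⟩)
      (ih (by omega))

/-- The element that alters the sign of coordinate `n`. -/
def flipElt (b : ℕ → G) (n : ℕ) : G := cosetRep b n (2 * n + 1)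

theorem flipElt_zero : flipElt b 0 = b 0 := by simp [flipElt, cosetRep]

theorem flipElt_succ : flipElt b (n + 1) = b (n + 1) * flipElt b n * b (n + 1) := by
  rw [flipElt, flipElt, mul_assoc, ← cosetRep_succ_succ,
    cosetRep_succ_of_eq (k := 2 * (n + 1)) (i := n + 1) (by omega)]
  rfl

namespace IsTypeBSequence

variable (hb : IsTypeBSequence b l)
include hb

theorem comm' {i j : ℕ} (hi : i < l) (hj : j < l) (h : i + 1 < j ∨ j + 1 < i) :
    b i * b j = b j * b i := by
  rcases h with h | h
  · exact hb.comm i j h hj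
  · exact (hb.comm j i h hi).symm

/-- All letters of the suffix have index greater than `j + 1`. -/
theorem mul_cosetRep_of_add_lt (hn : n < l) {j k : ℕ} (h : j + k < n) :
    b j * cosetRep b n k = cosetRep b n k * b j := by
  induction k with
  | zero => simp [cosetRep]
  | succ k ih =>
    rw [cosetRep_succ_of_eq (i := n - k) (by omega), ← mul_assoc,
      hb.comm j (n - k) (by omega) (by omega), mul_assoc, ih (by omega), mul_assoc]

/-- Both `b (j - 1)` and `b j` occur in the descending part. The factor `b j` commutes down to them,
one braid relation turns it into `b (j - 1)`, and that commutes with the remaining letters. -/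
theorem mul_cosetRep_of_lt_add (hn : n < l) {j k : ℕ} (hk : k ≤ n) (hj : j ≤ n)
    (h : n + 1 < j + k) :
    b j * cosetRep b n k = cosetRep b n k * b (j - 1) := by
  induction k with
  | zero => omega
  | succ k ih =>
    rw [cosetRep_succ_of_eq (i := n - k) (by omega)]
    by_cases h' : n + 1 < j + k
    · rw [← mul_assoc, hb.comm' (by omega) (by omega) (Or.inr (by omega)), mul_assoc,
        ih (by omega) h', mul_assoc]
    -- Here the word starts with `b (j - 1) b j`, which is where the braid relation applies.
    · obtain ⟨k, rfl⟩ : ∃ m, k = m + 1 := ⟨k - 1, by omega⟩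
      obtain ⟨i, rfl⟩ : ∃ i, j = i + 2 := ⟨j - 2, by omega⟩
      have e : n - (k + 1) = i + 1 := by omega
      have e' : i + 2 - 1 = i + 1 := by omega
      rw [cosetRep_succ_of_eq (i := i + 2) (by omega), e, e', ← mul_assoc, ← mul_assoc,
        ← hb.braid i (by omega), mul_assoc, hb.mul_cosetRep_of_add_lt hn (by omega)]
      simp only [mul_assoc]

/-- The letters `b m … b 0` to the left of the descending part commute with `b j`; the descending
part then lowers the index by one. -/
theorem mul_cosetRep_up_of_gt (hn : n < l) {j m : ℕ} (hj : j ≤ n) (h : m + 1 < j) :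
    b j * cosetRep b n (n + 1 + m) = cosetRep b n (n + 1 + m) * b (j - 1) := by
  induction m with
  | zero =>
    rw [add_zero, cosetRep_succ_of_eq (i := 0) (by omega), ← mul_assoc,
      ← hb.comm 0 j (by omega) (by omega), mul_assoc,
      hb.mul_cosetRep_of_lt_add hn le_rfl hj (by omega), mul_assoc]
  | succ m ih =>
    rw [← add_assoc, cosetRep_succ_of_eq (i := m + 1) (by omega), ← mul_assoc,
      ← hb.comm (m + 1) j (by omega) (by omega), mul_assoc, ih (by omega), mul_assoc]

/-- The index is raised to `j + 1` by a braid relation on the left side of the palindrome and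
lowered back to `j` on the right side. For `j = 0` the four-term relation does both at once. -/
theorem mul_cosetRep_up_of_lt (hn : n < l) {j m : ℕ} (hm : m ≤ n) (h : j < m) :
    b j * cosetRep b n (n + 1 + m) = cosetRep b n (n + 1 + m) * b j := by
  induction m with
  | zero => omega
  | succ m ih =>
    rw [← add_assoc, cosetRep_succ_of_eq (i := m + 1) (by omega)]
    by_cases h' : j < m
    · rw [← mul_assoc, hb.comm j (m + 1) (by omega) (by omega), mul_assoc, ih (by omega) h',
        mul_assoc]
    · obtain rfl : j = m := by omega
      cases j with
      | zero =>
        obtain ⟨n, rfl⟩ : ∃ m, n = m + 1 := ⟨n - 1, by omega⟩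
        have h0 := hb.mul_cosetRep_of_add_lt (j := 0) (k := n) hn (by omega)
        have h1 := hb.braid_zero (by omega)
        rw [add_zero, cosetRep_succ_of_eq (k := n + 1) (i := 0) (by omega),
          cosetRep_succ_of_eq (k := n) (i := 1) (by omega)]
        calc b 0 * (b 1 * (b 0 * (b 1 * cosetRep b (n + 1) n)))
            = (b 0 * b 1 * b 0 * b 1) * cosetRep b (n + 1) n := by simp only [mul_assoc]
          _ = b 1 * b 0 * b 1 * (b 0 * cosetRep b (n + 1) n) := by rw [h1]; simp only [mul_assoc]
          _ = _ := by rw [h0]; simp only [mul_assoc, zero_add]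
      | succ i =>
        have h0 := hb.mul_cosetRep_up_of_gt (j := i + 2) (m := i) hn (by omega) (by omega)
        have e : n + 1 + (i + 1) = (n + 1 + i) + 1 := by omega
        rw [e, cosetRep_succ_of_eq (k := n + 1 + i) (i := i + 1) (by omega)]
        calc b (i + 1) * (b (i + 2) * (b (i + 1) * cosetRep b n (n + 1 + i)))
            = (b (i + 1) * b (i + 2) * b (i + 1)) * cosetRep b n (n + 1 + i) := by
              simp only [mul_assoc]
          _ = b (i + 2) * b (i + 1) * (b (i + 2) * cosetRep b n (n + 1 + i)) := by
              rw [hb.braid i (by omega)]; simp only [mul_assoc]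
          _ = _ := by rw [h0]; simp only [mul_assoc]; rfl

/-- Left multiplication by generators permutes the cosets of the standard parabolic subgroup. -/
theorem mul_cosetRep (hn : n < l) {j k : ℕ} (hj : j ≤ n) (hk : k ≤ 2 * n + 1) :
    (∃ k', k' ≤ 2 * n + 1 ∧ b j * cosetRep b n k = cosetRep b n k') ∨
      ∃ j', j' < n ∧ b j * cosetRep b n k = cosetRep b n k * b j' := by
  -- Either `b j` is the next letter of the long word, or it cancels the leading letter of the
  -- suffix, or it slides through.
  by_cases h1 : k ≤ 2 * n ∧ (n - k) + (k - n) = j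
  · exact Or.inl ⟨k + 1, by omega, (cosetRep_succ_of_eq h1.2).symm⟩
  by_cases h2 : 0 < k ∧ (n - (k - 1)) + (k - 1 - n) = j
  · obtain ⟨k, rfl⟩ : ∃ m, k = m + 1 := ⟨k - 1, by omega⟩
    refine Or.inl ⟨k, by omega, ?_⟩
    rw [cosetRep_succ_of_eq (i := j) (by omega), ← mul_assoc, hb.sq j (by omega), one_mul]
  right
  by_cases h3 : k ≤ n
  · rcases lt_or_ge (j + k) n with h | h
    · exact ⟨j, by omega, hb.mul_cosetRep_of_add_lt hn h⟩
    · exact ⟨j - 1, by omega, hb.mul_cosetRep_of_lt_add hn h3 hj (by omega)⟩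
  · obtain ⟨m, rfl⟩ : ∃ m, k = n + 1 + m := ⟨k - (n + 1), by omega⟩
    rcases lt_or_ge j m with h | h
    · exact ⟨j, by omega, hb.mul_cosetRep_up_of_lt hn (by omega) h⟩
    · exact ⟨j - 1, by omega, hb.mul_cosetRep_up_of_gt hn hj (by omega)⟩

theorem flipElt_mul_self (hn : n < l) : flipElt b n * flipElt b n = 1 := by
  induction n with
  | zero => rw [flipElt_zero, hb.sq 0 hn]
  | succ n ih =>
    rw [flipElt_succ]
    calc b (n + 1) * flipElt b n * b (n + 1) * (b (n + 1) * flipElt b n * b (n + 1))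
        = b (n + 1) * flipElt b n * (b (n + 1) * b (n + 1)) * flipElt b n * b (n + 1) := by
          simp only [mul_assoc]
      _ = b (n + 1) * (flipElt b n * flipElt b n) * b (n + 1) := by
          rw [hb.sq (n + 1) hn, mul_one]; simp only [mul_assoc]
      _ = 1 := by rw [ih (by omega), mul_one, hb.sq (n + 1) hn]

theorem mul_flipElt (hn : n < l) {j : ℕ} (hj : j < n) :
    b j * flipElt b n = flipElt b n * b j := by
  have := hb.mul_cosetRep_up_of_lt hn le_rfl hj
  rwa [show n + 1 + n = 2 * n + 1 by omega] at this

/-- The set of products of a suffix and an element of the smaller parabolic contains `1` and is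
stable under left multiplication by each generator. -/
theorem exists_mul_eq_cosetRep_mul (hn : n < l) {g : G}
    (hg : g ∈ Subgroup.closure (b '' Set.Iio (n + 1))) :
    ∃ k, k ≤ 2 * n + 1 ∧ ∃ h ∈ Subgroup.closure (b '' Set.Iio n), g = cosetRep b n k * h := by
  have key : ∀ j < n + 1, ∀ y : G,
      (∃ k, k ≤ 2 * n + 1 ∧ ∃ h ∈ Subgroup.closure (b '' Set.Iio n), y = cosetRep b n k * h) →
      ∃ k, k ≤ 2 * n + 1 ∧ ∃ h ∈ Subgroup.closure (b '' Set.Iio n),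
        b j * y = cosetRep b n k * h := by
    rintro j hj y ⟨k, hk, h, hh, rfl⟩
    rcases hb.mul_cosetRep hn (Nat.lt_succ_iff.1 hj) hk with ⟨k', hk', e⟩ | ⟨j', hj', e⟩
    · exact ⟨k', hk', h, hh, by rw [← mul_assoc, e]⟩
    · exact ⟨k, hk, b j' * h, mul_mem (Subgroup.subset_closure ⟨j', hj', rfl⟩) hh,
        by rw [← mul_assoc, e, mul_assoc]⟩
  induction hg using Subgroup.closure_induction_left with
  | one => exact ⟨0, by omega, 1, one_mem _, by simp [cosetRep]⟩
  | mul_left x hx y hy ih =>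
    obtain ⟨j, hj, rfl⟩ := hx
    exact key j hj y ih
  | inv_mul_cancel x hx y hy ih =>
    obtain ⟨j, hj, rfl⟩ := hx
    rw [inv_eq_of_mul_eq_one_left (hb.sq j (by have := Set.mem_Iio.1 hj; omega))]
    exact key j hj y ih

end IsTypeBSequence

/-! ### Signed permutations of coordinates; faithfulness in type B. -/

/-- The generators act on the coordinates of the points of `X` by changing the sign of
coordinate `0`, and by exchanging the coordinates `i` and `i + 1`. -/
structure ActsOnCoords {X : Type*} (π : G →* Equiv.Perm X) (b : ℕ → G) (l : ℕ)
    (coord : X → ℕ → Bool) : Prop where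
  zero : 0 < l → ∀ x p, coord (π (b 0) x) p = if p = 0 then !coord x p else coord x p
  succ : ∀ i, i + 1 < l → ∀ x p, coord (π (b (i + 1)) x) p = coord x (Equiv.swap i (i + 1) p)
  surj : ∀ u : ℕ → Bool, ∃ x, ∀ p < l, coord x p = u p

namespace ActsOnCoords

variable {X : Type*} {π : G →* Equiv.Perm X} {coord : X → ℕ → Bool}
  (hπ : ActsOnCoords π b l coord)
include hπ

/-- Each descending letter carries the symbol that started at `n` one position further down. -/
theorem cosetRep_low (hn : n < l) {k : ℕ} (hk : k ≤ n) (x : X) :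
    coord (π (cosetRep b n k) x) (n - k) = coord x n := by
  induction k with
  | zero => simp [cosetRep]
  | succ k ih =>
    obtain ⟨i, hi⟩ : ∃ i, n - k = i + 1 := ⟨n - k - 1, by omega⟩
    have e : n - (k + 1) = i := by omega
    rw [cosetRep_succ_of_eq (i := i + 1) (by omega), map_mul, Equiv.Perm.mul_apply, e,
      hπ.succ i (by omega), Equiv.swap_apply_left, ← hi, ih (by omega)]

/-- At position `0` the letter `b 0` negates the travelling symbol; the ascending letters then carry
it back up. -/
theorem cosetRep_high (hn : n < l) {m : ℕ} (hm : m ≤ n) (x : X) :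
    coord (π (cosetRep b n (n + 1 + m)) x) m = !coord x n := by
  induction m with
  | zero =>
    have := hπ.cosetRep_low hn le_rfl x
    rw [add_zero, cosetRep_succ_of_eq (i := 0) (by omega), map_mul, Equiv.Perm.mul_apply,
      hπ.zero (by omega), if_pos rfl, ← this, Nat.sub_self]
  | succ m ih =>
    rw [← add_assoc, cosetRep_succ_of_eq (i := m + 1) (by omega), map_mul, Equiv.Perm.mul_apply,
      hπ.succ m (by omega), Equiv.swap_apply_right, ih (by omega)]

theorem flipElt (hn : n < l) (x : X) (p : ℕ) :
    coord (π (flipElt b n) x) p = if p = n then !coord x p else coord x p := by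
  induction n generalizing x p with
  | zero => rw [flipElt_zero, hπ.zero hn]
  | succ n ih =>
    rw [flipElt_succ, map_mul, map_mul, Equiv.Perm.mul_apply, Equiv.Perm.mul_apply,
      hπ.succ n hn, ih (by omega), hπ.succ n hn, Equiv.swap_apply_self]
    have : Equiv.swap n (n + 1) p = n ↔ p = n + 1 := by
      rw [Equiv.swap_apply_eq_iff, Equiv.swap_apply_left]
    simp only [this]

theorem apply_of_mem_closure (hn : n ≤ l) {g : G} (hg : g ∈ Subgroup.closure (b '' Set.Iio n))
    {p : ℕ} (hp : n ≤ p) (x : X) : coord (π g x) p = coord x p := by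
  induction hg using Subgroup.closure_induction generalizing x with
  | mem g hg =>
    obtain ⟨i, hi, rfl⟩ := hg
    rw [Set.mem_Iio] at hi
    cases i with
    | zero => rw [hπ.zero (by omega), if_neg (by omega)]
    | succ i => rw [hπ.succ i (by omega), Equiv.swap_apply_of_ne_of_ne (by omega) (by omega)]
  | one => simp
  | mul g h _ _ hg hh => rw [map_mul, Equiv.Perm.mul_apply, hg, hh]
  | inv g _ hg => rw [← hg (π g⁻¹ x), ← Equiv.Perm.mul_apply, ← map_mul, mul_inv_cancel, map_one,
      Equiv.Perm.one_apply]

/-- Needed because coordinates need not determine a point of `X`: in the affine application there is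
also a level. -/
theorem congr_of_mem_closure (hb : IsTypeBSequence b l) (hn : n ≤ l) {g : G} (hg : g ∈ Subgroup.closure (b '' Set.Iio n))
    {x y : X} (hxy : coord x = coord y) : coord (π g x) = coord (π g y) := by
  have key : ∀ j < n, ∀ x y, coord x = coord y → coord (π (b j) x) = coord (π (b j) y) := by
    intro j hj x y hxy
    ext p
    cases j with
    | zero => rw [hπ.zero (by omega), hπ.zero (by omega), hxy]
    | succ i => rw [hπ.succ i (by omega), hπ.succ i (by omega), hxy]
  induction hg using Subgroup.closure_induction_left generalizing x y with
  | one => simpa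
  | mul_left g hg h _ hh =>
    obtain ⟨i, hi, rfl⟩ := hg
    rw [map_mul, Equiv.Perm.mul_apply, Equiv.Perm.mul_apply]
    exact key i hi _ _ (hh hxy)
  | inv_mul_cancel g hg h _ hh =>
    obtain ⟨i, hi, rfl⟩ := hg
    rw [inv_eq_of_mul_eq_one_left (hb.sq i (lt_of_lt_of_le hi hn)), map_mul,
      Equiv.Perm.mul_apply, Equiv.Perm.mul_apply]
    exact key i hi _ _ (hh hxy)

/-- The group of type `B_n` acts faithfully on the coordinates. -/
theorem eq_one (hb : IsTypeBSequence b l) (hn : n ≤ l) {g : G}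
    (hg : g ∈ Subgroup.closure (b '' Set.Iio n))
    (h : ∀ x, ∀ p < n, coord (π g x) p = coord x p) : g = 1 := by
  induction n generalizing g with
  | zero => simpa using hg
  | succ n ih =>
    have hn' : n < l := hn
    obtain ⟨k, hk, h', hh', rfl⟩ := hb.exists_mul_eq_cosetRep_mul hn hg
    have hfix := fun x => hπ.apply_of_mem_closure hn'.le hh' le_rfl x
    rcases Nat.eq_zero_or_pos k with rfl | hk0
    · rw [cosetRep, one_mul] at h ⊢
      exact ih hn'.le hh' fun x p hp => h x p (by omega)
    · exfalso
      by_cases hkn : k ≤ n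
      -- The single `true` at `n` is carried to `n - k`, which is a different position since `k >
      -- 0`.
      · obtain ⟨x, hx⟩ := hπ.surj (fun p => decide (p = n))
        have h1 := h x (n - k) (by omega)
        rw [map_mul, Equiv.Perm.mul_apply, hπ.cosetRep_low hn' hkn, hfix, hx n hn',
          hx (n - k) (by omega)] at h1
        simp at h1; omega
      · obtain ⟨m, rfl⟩ : ∃ m, k = n + 1 + m := ⟨k - (n + 1), by omega⟩
        -- On the constant string the negated symbol is detected wherever it lands, including at
        -- position `n` itself.
        obtain ⟨x, hx⟩ := hπ.surj (fun p => false)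
        have h1 := h x m (by omega)
        rw [map_mul, Equiv.Perm.mul_apply, hπ.cosetRep_high hn' (by omega), hfix, hx n hn',
          hx m (by omega)] at h1
        simp at h1

end ActsOnCoords

end cosetRep

/-! ### Extending a sequence of type `B` to the affine type `C` -/

/-- The elements `a, b n, b (n - 1), …, b 0` satisfy the Coxeter relations of the affine type
`C_{n+1}^{(1)}`. -/
structure IsAffineSequence {G : Type*} [Group G] (a : G) (b : ℕ → G) (n : ℕ) : Prop
    extends IsTypeBSequence b (n + 1) where
  pos : 0 < n
  sq_a : a * a = 1
  comm_a : ∀ i < n, a * b i = b i * a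
  braid_a : a * b n * a * b n = b n * a * b n * a

section affine

variable {G : Type*} [Group G] {a : G} {b : ℕ → G} {n : ℕ}

/-! ### The commutative group of translations. -/

/-- The translations along the coordinate axes. -/
def translation (a : G) (b : ℕ → G) (n k : ℕ) : G :=
  cosetRep b n k * (a * flipElt b n) * (cosetRep b n k)⁻¹

/-- The group of translations. -/
def translationSubgroup (a : G) (b : ℕ → G) (n : ℕ) : Subgroup G :=
  Subgroup.closure (translation a b n '' Set.Iic n)

theorem translation_zero : translation a b n 0 = a * flipElt b n := by
  simp [translation, cosetRep]

namespace IsAffineSequence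

variable (hab : IsAffineSequence a b n)
include hab

theorem comm_a_of_mem {h : G} (hh : h ∈ Subgroup.closure (b '' Set.Iio n)) : a * h = h * a := by
  have : Subgroup.closure (b '' Set.Iio n) ≤ Subgroup.centralizer {a} := by
    rw [Subgroup.closure_le]
    rintro _ ⟨i, hi, rfl⟩
    rw [SetLike.mem_coe, Subgroup.mem_centralizer_singleton_iff]
    exact (hab.comm_a i hi).symm
  exact (Subgroup.mem_centralizer_singleton_iff.1 (this hh)).symm

theorem comm_flipElt_of_mem {h : G} (hh : h ∈ Subgroup.closure (b '' Set.Iio n)) :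
    flipElt b n * h = h * flipElt b n := by
  have : Subgroup.closure (b '' Set.Iio n) ≤ Subgroup.centralizer {flipElt b n} := by
    rw [Subgroup.closure_le]
    rintro _ ⟨i, hi, rfl⟩
    rw [SetLike.mem_coe, Subgroup.mem_centralizer_singleton_iff]
    exact hab.mul_flipElt (Nat.lt_succ_self n) hi
  exact (Subgroup.mem_centralizer_singleton_iff.1 (this hh)).symm

theorem commute_of_mem {h : G} (hh : h ∈ Subgroup.closure (b '' Set.Iio n)) :
    Commute (a * flipElt b n) h := by
  rw [Commute, SemiconjBy, mul_assoc, hab.comm_flipElt_of_mem hh, ← mul_assoc,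
    hab.comm_a_of_mem hh, mul_assoc]

theorem b_inv {j : ℕ} (hj : j ≤ n) : (b j)⁻¹ = b j :=
  inv_eq_of_mul_eq_one_left (hab.sq j (by omega))

/-- Write `c = b n` and let `h` be the flip of coordinate `n - 1`, so that `flipElt b n = c h c`.
The two products reduce to `a c a h c h` and `c a c a h c h c`. They agree by the four-term relation
for `a, c` and the same relation for `c, h`, which says that the two flips commute. -/
theorem commute_translation_one : Commute (a * flipElt b n) (b n * (a * flipElt b n) * b n) := by
  obtain ⟨m, rfl⟩ : ∃ m, n = m + 1 := ⟨n - 1, by have := hab.pos; omega⟩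
  have hmem : flipElt b m ∈ Subgroup.closure (b '' Set.Iio (m + 1)) := cosetRep_mem _ le_rfl
  have hf := hab.comm_flipElt_of_mem hmem
  have ha := hab.comm_a_of_mem hmem
  have hsq := hab.sq (m + 1) (by omega)
  have hbr := hab.braid_a
  rw [flipElt_succ] at hf ⊢
  generalize flipElt b m = h at *
  generalize b (m + 1) = c at *
  have hc : ∀ x, c * (c * x) = x := fun x => by rw [← mul_assoc, hsq, one_mul]
  have hah : ∀ x, h * (a * x) = a * (h * x) := fun x => by rw [← mul_assoc, ← ha, mul_assoc]
  have hbr' : ∀ x, a * (c * (a * (c * x))) = c * (a * (c * (a * x))) := fun x => by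
    simpa only [mul_assoc] using congrArg (· * x) hbr
  have hf' : c * (h * (c * h)) = h * (c * (h * c)) := by simpa only [mul_assoc] using hf
  rw [Commute, SemiconjBy]
  simp only [mul_assoc, hc, hsq, mul_one, hah, hbr', ← hf']

theorem translation_top :
    translation a b n (2 * n + 1) = (a * flipElt b n)⁻¹ := by
  have hff := hab.flipElt_mul_self (Nat.lt_succ_self n)
  rw [translation, ← flipElt, mul_inv_rev, inv_eq_of_mul_eq_one_left hff,
    inv_eq_of_mul_eq_one_left hab.sq_a]
  simp only [mul_assoc, hff, mul_one]

/-- For intermediate `k` the coset word is an element of the smaller parabolic times `b n`. That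
parabolic centralizes `a * flipElt b n`, so only the conjugate by `b n` has to be treated. -/
theorem commute_translation {k : ℕ} (hk : k ≤ 2 * n + 1) :
    Commute (a * flipElt b n) (translation a b n k) := by
  rcases Nat.eq_zero_or_pos k with rfl | hk0
  · rw [translation_zero]
  rcases hk.eq_or_lt with rfl | hk1
  · rw [hab.translation_top]
    exact (Commute.refl _).inv_right
  · obtain ⟨m, rfl⟩ : ∃ m, n = m + 1 := ⟨n - 1, by have := hab.pos; omega⟩
    obtain ⟨k, rfl⟩ : ∃ m, k = m + 1 := ⟨k - 1, by omega⟩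
    have h1 := hab.commute_of_mem (cosetRep_mem (b := b) (n := m) k (by omega))
    have h2 := hab.commute_translation_one
    have h3 := (h1.mul_right h2).mul_right h1.inv_right
    rw [translation, cosetRep_succ_succ, mul_inv_rev, hab.b_inv le_rfl]
    simpa only [mul_assoc] using h3

/-- The long word is a palindrome, so lengthening one suffix and shortening the complementary one
conjugate by the same letter. Hence the `2 n + 2` conjugates form inverse pairs, and `n + 1` of them
generate. -/
theorem translation_compl {k : ℕ} (hk : k ≤ 2 * n + 1) :
    translation a b n (2 * n + 1 - k) = (translation a b n k)⁻¹ := by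
  induction k with
  | zero => rw [Nat.sub_zero, hab.translation_top, translation_zero]
  | succ k ih =>
    have ih := ih (by omega)
    obtain ⟨i, hi⟩ : ∃ i, (n - k) + (k - n) = i := ⟨_, rfl⟩
    have hin : i ≤ n := by omega
    have e : 2 * n + 1 - k = (2 * n + 1 - (k + 1)) + 1 := by omega
    have hs : ∀ x, b i * (b i * x) = x := fun x => by
      rw [← mul_assoc, hab.sq i (by omega), one_mul]
    rw [e, translation, cosetRep_succ_of_eq (i := i) (by omega), mul_inv_rev,
      hab.b_inv hin] at ih
    have h1 : translation a b n (k + 1) = b i * translation a b n k * b i := by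
      rw [translation, cosetRep_succ_of_eq hi, mul_inv_rev, hab.b_inv hin, translation]
      simp only [mul_assoc]
    rw [h1, mul_inv_rev, mul_inv_rev, hab.b_inv hin, ← ih, translation]
    simp only [mul_assoc, hs, hab.sq i (by omega), mul_one]

theorem translation_mem {k : ℕ} (hk : k ≤ 2 * n + 1) :
    translation a b n k ∈ translationSubgroup a b n := by
  rcases le_or_gt k n with h | h
  · exact Subgroup.subset_closure ⟨k, h, rfl⟩
  · have := hab.translation_compl hk
    rw [← inv_inv (translation a b n k), ← this]
    exact inv_mem (Subgroup.subset_closure ⟨_, by simp only [Set.mem_Iic]; omega, rfl⟩)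

theorem b_mul_translation {j k : ℕ} (hj : j ≤ n) (hk : k ≤ 2 * n + 1) :
    ∃ k', k' ≤ 2 * n + 1 ∧ b j * translation a b n k * (b j)⁻¹ = translation a b n k' := by
  -- A generator that slides through the coset word becomes a generator centralizing `a * flipElt b
  -- n`, and so disappears from the conjugate.
  rcases hab.mul_cosetRep (Nat.lt_succ_self n) hj hk with ⟨k', hk', e⟩ | ⟨j', hj', e⟩
  · refine ⟨k', hk', ?_⟩
    rw [translation, translation, ← e, mul_inv_rev]
    simp only [mul_assoc]
  · refine ⟨k, hk, ?_⟩
    have hc := (hab.commute_of_mem (Subgroup.subset_closure ⟨j', hj', rfl⟩)).symm.eq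
    calc b j * translation a b n k * (b j)⁻¹
        = (b j * cosetRep b n k) * (a * flipElt b n) * (b j * cosetRep b n k)⁻¹ := by
          rw [translation, mul_inv_rev]; simp only [mul_assoc]
      _ = cosetRep b n k * (b j' * (a * flipElt b n)) * (b j')⁻¹ * (cosetRep b n k)⁻¹ := by
          rw [e, mul_inv_rev]; simp only [mul_assoc]
      _ = translation a b n k := by
          rw [hc, translation]; simp only [mul_assoc, mul_inv_cancel_left]

theorem conj_mem {w x : G} (hw : w ∈ Subgroup.closure (b '' Set.Iio (n + 1)))
    (hx : x ∈ translationSubgroup a b n) : w * x * w⁻¹ ∈ translationSubgroup a b n := by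
  have key : ∀ j < n + 1, ∀ x ∈ translationSubgroup a b n,
      b j * x * (b j)⁻¹ ∈ translationSubgroup a b n := by
    intro j hj x hx
    have : translationSubgroup a b n ≤
        (translationSubgroup a b n).comap (MulAut.conj (b j)).toMonoidHom := by
      conv_lhs => rw [translationSubgroup]
      rw [Subgroup.closure_le]
      rintro _ ⟨k, hk, rfl⟩
      rw [Set.mem_Iic] at hk
      obtain ⟨k', hk', e⟩ := hab.b_mul_translation (j := j) (k := k) (by omega) (by omega)
      simp only [SetLike.mem_coe, Subgroup.mem_comap, MulEquiv.coe_toMonoidHom,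
        MulAut.conj_apply, e]
      exact hab.translation_mem hk'
    simpa using this hx
  induction hw using Subgroup.closure_induction_left generalizing x with
  | one => simpa
  | mul_left g hg h _ hh =>
    obtain ⟨i, hi, rfl⟩ := hg
    have := key i hi _ (hh hx)
    simpa only [mul_inv_rev, mul_assoc] using this
  | inv_mul_cancel g hg h _ hh =>
    obtain ⟨i, hi, rfl⟩ := hg
    have := key i hi _ (hh hx)
    rw [hab.b_inv (Nat.lt_succ_iff.1 hi)] at this ⊢
    simpa only [mul_inv_rev, mul_assoc, hab.b_inv (Nat.lt_succ_iff.1 hi)] using this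

/-- It is enough that `a * flipElt b n` commutes with all its conjugates under the type B group; by
the coset decomposition these are just the translations. -/
theorem translation_comm {k m : ℕ} (hk : k ≤ n) (hm : m ≤ n) :
    translation a b n k * translation a b n m = translation a b n m * translation a b n k := by
  have key : ∀ w ∈ Subgroup.closure (b '' Set.Iio (n + 1)),
      Commute (a * flipElt b n) (w * (a * flipElt b n) * w⁻¹) := by
    intro w hw
    obtain ⟨i, hi, h, hh, rfl⟩ := hab.exists_mul_eq_cosetRep_mul (Nat.lt_succ_self n) hw
    have := (hab.commute_of_mem hh).symm.eq
    have e : cosetRep b n i * h * (a * flipElt b n) * (cosetRep b n i * h)⁻¹ =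
        translation a b n i := by
      rw [translation, mul_assoc (cosetRep b n i), this, mul_inv_rev]
      simp only [mul_assoc, mul_inv_cancel_left]
    rw [e]
    exact hab.commute_translation hi
  have hk' := cosetRep_mem (b := b) (n := n) k (by omega)
  have hm' := cosetRep_mem (b := b) (n := n) m (by omega)
  have h := (key _ (mul_mem (inv_mem hk') hm')).eq
  rw [translation, translation]
  generalize cosetRep b n k = r at *
  generalize cosetRep b n m = r' at *
  generalize a * flipElt b n = t at *
  have := congrArg (fun x => r * x * r⁻¹) h
  simpa [mul_assoc] using this

theorem exists_eq_mul (hG : Subgroup.closure (insert a (b '' Set.Iio (n + 1))) = ⊤) (g : G) :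
    ∃ x ∈ translationSubgroup a b n, ∃ w ∈ Subgroup.closure (b '' Set.Iio (n + 1)),
      g = x * w := by
  have hf : flipElt b n ∈ Subgroup.closure (b '' Set.Iio (n + 1)) := cosetRep_mem _ le_rfl
  have hff := hab.flipElt_mul_self (Nat.lt_succ_self n)
  have key : ∀ s ∈ insert a (b '' Set.Iio (n + 1)), ∀ y : G,
      (∃ x ∈ translationSubgroup a b n, ∃ w ∈ Subgroup.closure (b '' Set.Iio (n + 1)),
        y = x * w) →
      ∃ x ∈ translationSubgroup a b n, ∃ w ∈ Subgroup.closure (b '' Set.Iio (n + 1)),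
        s * y = x * w := by
    rintro s (rfl | hs) y ⟨x, hx, w, hw, rfl⟩
    -- Since the flip is an involution, `s` is the zeroth translation times the flip; the flip is
    -- then moved past `x` by conjugation.
    · refine ⟨translation s b n 0 * (flipElt b n * x * (flipElt b n)⁻¹),
        mul_mem (hab.translation_mem (by omega)) (hab.conj_mem hf hx), flipElt b n * w,
        mul_mem hf hw, ?_⟩
      rw [translation_zero]
      have : ∀ z, flipElt b n * (flipElt b n * z) = z := fun z => by
        rw [← mul_assoc, hff, one_mul]
      simp only [mul_assoc, this, inv_mul_cancel_left]
    · have hs' := Subgroup.subset_closure hs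
      refine ⟨s * x * s⁻¹, hab.conj_mem hs' hx, s * w, mul_mem hs' hw, ?_⟩
      simp only [mul_assoc, inv_mul_cancel_left]
  have hinv : ∀ s ∈ insert a (b '' Set.Iio (n + 1)), s⁻¹ = s := by
    rintro s (rfl | ⟨i, hi, rfl⟩)
    · exact inv_eq_of_mul_eq_one_left hab.sq_a
    · exact hab.b_inv (Nat.lt_succ_iff.1 hi)
  have hg : g ∈ Subgroup.closure (insert a (b '' Set.Iio (n + 1))) := hG ▸ Subgroup.mem_top g
  induction hg using Subgroup.closure_induction_left with
  | one => exact ⟨1, one_mem _, 1, one_mem _, by simp⟩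
  | mul_left s hs y _ ih => exact key s hs y ih
  | inv_mul_cancel s hs y _ ih => exact (hinv s hs).symm ▸ key s hs y ih

open scoped IsMulCommutative in
/-- Evaluating additive functions on products of powers of translations. -/
theorem exists_exponents {x : G} (hx : x ∈ translationSubgroup a b n) :
    ∃ c : Fin (n + 1) → ℤ, (c = 0 → x = 1) ∧
      ∀ φ : translationSubgroup a b n →* Multiplicative ℤ, (φ ⟨x, hx⟩).toAdd =
        ∑ k : Fin (n + 1),
          c k * (φ ⟨translation a b n k, hab.translation_mem (by omega)⟩).toAdd := by
  -- Commutativity makes every element a product of integer powers of the generating translations.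
  have : IsMulCommutative (translationSubgroup a b n) := by
    apply Subgroup.isMulCommutative_closure
    rintro _ ⟨k, hk, rfl⟩ _ ⟨m, hm, rfl⟩
    exact hab.translation_comm hk hm
  let f : Fin (n + 1) → translationSubgroup a b n := fun k =>
    ⟨translation a b n k, hab.translation_mem (by omega)⟩
  have hx' : (⟨x, hx⟩ : translationSubgroup a b n) ∈ Subgroup.closure (Set.range f) := by
    have h : Set.range f = (((↑) : translationSubgroup a b n → G) ⁻¹'
        (translation a b n '' Set.Iic n)) := by
      ext y
      constructor
      · rintro ⟨k, rfl⟩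
        exact ⟨k, by simp only [Set.mem_Iic]; omega, rfl⟩
      · rintro ⟨k, hk, e⟩
        exact ⟨⟨k, Nat.lt_succ_of_le hk⟩, Subtype.ext e⟩
    have h' : Subgroup.closure (((↑) : translationSubgroup a b n → G) ⁻¹'
        (translation a b n '' Set.Iic n)) = ⊤ := Subgroup.closure_closure_coe_preimage
    rw [h, h']
    exact Subgroup.mem_top _
  obtain ⟨c, hc⟩ := Subgroup.exists_of_mem_closure_range f _ hx'
  refine ⟨c, ?_, ?_⟩
  · rintro rfl
    simpa using congrArg Subtype.val hc
  · intro φ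
    rw [hc, map_prod, toAdd_prod]
    simp only [map_zpow, toAdd_zpow, smul_eq_mul]
    rfl

end IsAffineSequence

/-! ### Faithfulness in the affine case. -/

/-- The action on points with a level and coordinates, where `a` changes the sign of coordinate `n`
and moves the level up or down according to that sign. -/
structure ActsAffinely {X : Type*} (π : G →* Equiv.Perm X) (a : G) (b : ℕ → G) (n : ℕ)
    (level : X → ℤ) (coord : X → ℕ → Bool) : Prop
    extends ActsOnCoords π b (n + 1) coord where
  level_b : ∀ i ≤ n, ∀ x, level (π (b i) x) = level x
  level_a : ∀ x, level (π a x) = level x + if coord x n = true then 1 else -1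
  coord_a : ∀ x p, coord (π a x) p = if p = n then !coord x p else coord x p

namespace ActsAffinely

variable {X : Type*} {π : G →* Equiv.Perm X} {level : X → ℤ} {coord : X → ℕ → Bool}
  (hπ : ActsAffinely π a b n level coord)
include hπ

theorem level_of_mem {w : G} (hw : w ∈ Subgroup.closure (b '' Set.Iio (n + 1))) (x : X) :
    level (π w x) = level x := by
  induction hw using Subgroup.closure_induction generalizing x with
  | mem g hg =>
    obtain ⟨i, hi, rfl⟩ := hg
    exact hπ.level_b i (Nat.lt_succ_iff.1 hi) x
  | one => simp
  | mul g h _ _ hg hh => rw [map_mul, Equiv.Perm.mul_apply, hg, hh]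
  | inv g _ hg =>
    rw [← hg (π g⁻¹ x), ← Equiv.Perm.mul_apply, ← map_mul, mul_inv_cancel, map_one,
      Equiv.Perm.one_apply]

theorem coord_translation_zero (x : X) : coord (π (a * flipElt b n) x) = coord x := by
  ext p
  rw [map_mul, Equiv.Perm.mul_apply, hπ.coord_a, hπ.flipElt (Nat.lt_succ_self n)]
  split_ifs <;> simp

/-- The flip acts before `a`, so `a` sees the opposite symbol; hence the sign is reversed compared
with `level_a`. -/
theorem level_translation_zero (x : X) :
    level (π (a * flipElt b n) x) = level x + if coord x n = true then -1 else 1 := by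
  rw [map_mul, Equiv.Perm.mul_apply, hπ.level_a, hπ.flipElt (Nat.lt_succ_self n),
    hπ.level_of_mem (w := flipElt b n) (cosetRep_mem _ le_rfl), if_pos rfl]
  cases coord x n <;> simp

theorem coord_translation (hab : IsAffineSequence a b n) {k : ℕ} (hk : k ≤ 2 * n + 1) (x : X) :
    coord (π (translation a b n k) x) = coord x := by
  have h := hπ.congr_of_mem_closure hab.toIsTypeBSequence le_rfl
    (cosetRep_mem (b := b) (n := n) k hk)
    (hπ.coord_translation_zero (π (cosetRep b n k)⁻¹ x))
  rw [translation, map_mul, map_mul, Equiv.Perm.mul_apply, Equiv.Perm.mul_apply, h,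
    ← Equiv.Perm.mul_apply, ← map_mul, mul_inv_cancel, map_one, Equiv.Perm.one_apply]

theorem level_translation {k : ℕ} (hk : k ≤ n) (x : X) :
    level (π (translation a b n k) x) =
      level x + if coord x (n - k) = true then -1 else 1 := by
  have hm := cosetRep_mem (b := b) (n := n) k (by omega)
  have h := hπ.cosetRep_low (Nat.lt_succ_self n) hk (π (cosetRep b n k)⁻¹ x)
  rw [← Equiv.Perm.mul_apply, ← map_mul, mul_inv_cancel, map_one, Equiv.Perm.one_apply] at h
  rw [translation, map_mul, map_mul, Equiv.Perm.mul_apply, Equiv.Perm.mul_apply,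
    hπ.level_of_mem hm, hπ.level_translation_zero, hπ.level_of_mem (inv_mem hm), h]

/-- Translations preserve the coordinates, and move the level by an amount which only depends on
the coordinates. -/
theorem exists_displacement (hab : IsAffineSequence a b n) {g : G}
    (hg : g ∈ translationSubgroup a b n) :
    ∃ d : (ℕ → Bool) → ℤ, ∀ x, coord (π g x) = coord x ∧
      level (π g x) = level x + d (coord x) := by
  induction hg using Subgroup.closure_induction with
  | mem g hg =>
    obtain ⟨k, hk, rfl⟩ := hg
    rw [Set.mem_Iic] at hk
    exact ⟨fun u => if u (n - k) = true then -1 else 1, fun x =>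
      ⟨hπ.coord_translation hab (by omega) x, hπ.level_translation hk x⟩⟩
  | one => exact ⟨0, fun x => by simp⟩
  | mul g h _ _ hg hh =>
    obtain ⟨d, hd⟩ := hg
    obtain ⟨d', hd'⟩ := hh
    refine ⟨d + d', fun x => ?_⟩
    rw [map_mul, Equiv.Perm.mul_apply, (hd _).1, (hd _).2, (hd' _).1, (hd' _).2, Pi.add_apply]
    exact ⟨rfl, by ring⟩
  | inv g _ hg =>
    obtain ⟨d, hd⟩ := hg
    refine ⟨-d, fun x => ?_⟩
    have h := hd (π g⁻¹ x)
    rw [← Equiv.Perm.mul_apply, ← map_mul, mul_inv_cancel, map_one, Equiv.Perm.one_apply] at h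
    refine ⟨h.1.symm, ?_⟩
    rw [h.2, Pi.neg_apply, h.1]; ring

/-- Displacements add up because they depend only on the coordinates, which translations preserve.
-/
theorem exists_displacement_hom (hab : IsAffineSequence a b n) (y : X) :
    ∃ φ : translationSubgroup a b n →* Multiplicative ℤ, ∀ g : translationSubgroup a b n,
      level (π g y) = level y + (φ g).toAdd := by
  refine ⟨MonoidHom.mk' (fun g => Multiplicative.ofAdd (level (π g y) - level y)) ?_, ?_⟩
  · intro g h
    obtain ⟨d, hd⟩ := hπ.exists_displacement hab g.2
    have h1 := (hd (π h y)).2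
    have h2 := (hd y).2
    obtain ⟨d', hd'⟩ := hπ.exists_displacement hab h.2
    rw [(hd' y).1] at h1
    rw [← ofAdd_add, Subgroup.coe_mul, map_mul, Equiv.Perm.mul_apply, h1, h2]
    congr 1; ring
  · intro g
    simp

/-- The affine group acts faithfully on levels and coordinates. -/
theorem eq_one_of_affine (hab : IsAffineSequence a b n)
    (hG : Subgroup.closure (insert a (b '' Set.Iio (n + 1))) = ⊤) {g : G}
    (hg : π g = 1) : g = 1 := by
  obtain ⟨x, hx, w, hw, rfl⟩ := hab.exists_eq_mul hG g
  -- The translation `x` leaves coordinates alone, so `w` must fix them all.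
  have hw1 : w = 1 := by
    refine hπ.eq_one hab.toIsTypeBSequence le_rfl hw fun y p _ => ?_
    obtain ⟨d, hd⟩ := hπ.exists_displacement hab hx
    rw [← (hd (π w y)).1, ← Equiv.Perm.mul_apply, ← map_mul, hg, Equiv.Perm.one_apply]
  subst hw1
  rw [mul_one] at hg ⊢
  obtain ⟨c, hc, hsum⟩ := hab.exists_exponents hx
  -- The total displacement of `x` at a point with coordinates `u` is this signed sum of exponents.
  have hzero : ∀ u : ℕ → Bool,
      ∑ k : Fin (n + 1), c k * (if u (n - k) = true then -1 else 1) = 0 := by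
    intro u
    obtain ⟨y, hy⟩ := hπ.surj u
    obtain ⟨φ, hφ⟩ := hπ.exists_displacement_hom hab y
    have h0 := hφ ⟨x, hx⟩
    rw [hg, Equiv.Perm.one_apply, hsum φ] at h0
    have h1 : ∀ k : Fin (n + 1),
        (φ ⟨translation a b n k, hab.translation_mem (by omega)⟩).toAdd =
          if u (n - k) = true then -1 else 1 := by
      intro k
      have := hφ ⟨translation a b n k, hab.translation_mem (by omega)⟩
      rw [hπ.level_translation (by omega), hy _ (by omega)] at this
      linarith
    simp only [h1] at h0
    linarith
  refine hc (funext fun k => ?_)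
  have h1 := hzero fun _ => false
  -- This pattern differs from the constant one only in the sign of the `k`-th term, so the
  -- difference of the two sums is `2 * c k`.
  have h2 := hzero fun p => decide (p = n - k)
  have h3 := sub_eq_zero.2 (h1.trans h2.symm)
  rw [← Finset.sum_sub_distrib, Finset.sum_eq_single k] at h3
  · simp at h3
    simp only [Pi.zero_apply]
    omega
  · intro m _ hm
    have : (n - m : ℕ) ≠ n - k := fun e => hm (Fin.ext (by omega))
    simp [this]
  · simp

end ActsAffinely

end affine

/-! ### The Coxeter matrices of types `C_l` and `C_l^{(1)}` -/

theorem weylMatrix_cartanAffineC {l : ℕ} (hl : 2 ≤ l) (i j : Fin (l + 1)) :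
    weylMatrix (cartanAffineC l) i j =
      if i.val = j.val then 1
      else if i.val + 1 = j.val ∨ j.val + 1 = i.val then
        if i.val = 0 ∨ j.val = 0 ∨ i.val = l ∨ j.val = l then 4 else 3
      else 2 := by
  rw [cartanAffineC, weylMatrix_transpose]
  simp only [weylMatrix, Matrix.of_apply, cartanTwistedD, Fin.ext_iff, Fin.val_zero, Fin.val_last]
  split_ifs <;> first | rfl | omega

theorem weylMatrix_C {l : ℕ} (i j : Fin l) :
    weylMatrix (CartanMatrix.C l) i j =
      if i.val = j.val then 1
      else if i.val + 1 = j.val ∨ j.val + 1 = i.val then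
        if i.val + 1 = l ∨ j.val + 1 = l then 4 else 3
      else 2 := by
  simp only [weylMatrix, Matrix.of_apply, CartanMatrix.C, Fin.ext_iff]
  split_ifs <;> first | rfl | omega

theorem weylMatrix_C_eq {l : ℕ} (hl : 2 ≤ l) (i j : Fin l) :
    weylMatrix (CartanMatrix.C l) i j = weylMatrix (cartanAffineC l) i.succ j.succ := by
  rw [weylMatrix_C, weylMatrix_cartanAffineC hl]
  simp only [Fin.val_succ, Nat.add_eq_zero_iff, one_ne_zero, and_false, false_or]
  split_ifs <;> first | rfl | omega

/-! ### Braid relations of involutions -/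

section involutions

variable {G : Type*} [Group G] {x y : G}

theorem mul_pow_two_eq_one_iff_comm (hx : x * x = 1) (hy : y * y = 1) :
    (x * y) ^ 2 = 1 ↔ x * y = y * x := by
  have hx' := inv_eq_of_mul_eq_one_left hx
  have hy' := inv_eq_of_mul_eq_one_left hy
  rw [pow_two, mul_eq_one_iff_eq_inv, mul_inv_rev, hx', hy']

theorem mul_pow_three_eq_one_iff_braid (hx : x * x = 1) (hy : y * y = 1) :
    (x * y) ^ 3 = 1 ↔ x * y * x = y * x * y := by
  have hx' := inv_eq_of_mul_eq_one_left hx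
  have hy' := inv_eq_of_mul_eq_one_left hy
  have : (x * y) ^ 3 = (x * y * x) * (y * x * y) := by simp only [pow_succ, pow_zero, one_mul,
    mul_assoc]
  rw [this, mul_eq_one_iff_eq_inv, mul_inv_rev, mul_inv_rev, hx', hy', mul_assoc y]

theorem mul_pow_four_eq_one_iff_braid (hx : x * x = 1) (hy : y * y = 1) :
    (x * y) ^ 4 = 1 ↔ x * y * x * y = y * x * y * x := by
  have hx' := inv_eq_of_mul_eq_one_left hx
  have hy' := inv_eq_of_mul_eq_one_left hy
  have : (x * y) ^ 4 = (x * y * x * y) * (x * y * x * y) := by simp only [pow_succ, pow_zero,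
    one_mul, mul_assoc]
  rw [this, mul_eq_one_iff_eq_inv]
  simp only [mul_inv_rev, hx', hy', mul_assoc]

theorem mul_pow_eq_one_of_swap {m : ℕ} (hx : x * x = 1) (hy : y * y = 1)
    (h : (x * y) ^ m = 1) : (y * x) ^ m = 1 := by
  rw [← inv_eq_one, ← inv_pow, mul_inv_rev, inv_eq_of_mul_eq_one_left hx,
    inv_eq_of_mul_eq_one_left hy, h]

end involutions

section weylGen

variable {P : Type*} [DecidableEq P] {A : Matrix P P ℤ}

theorem weylGen_sq (i : P) : weylGen A i * weylGen A i = 1 :=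
  (weylMatrix A).toCoxeterSystem.simple_mul_simple_self i

theorem weylGen_pow (i j : P) : (weylGen A i * weylGen A j) ^ weylMatrix A i j = 1 :=
  (weylMatrix A).toCoxeterSystem.simple_mul_simple_pow i j

theorem weylGen_comm {i j : P} (h : weylMatrix A i j = 2) :
    weylGen A i * weylGen A j = weylGen A j * weylGen A i :=
  (mul_pow_two_eq_one_iff_comm (weylGen_sq i) (weylGen_sq j)).1 (h ▸ weylGen_pow i j)

theorem weylGen_braid_three {i j : P} (h : weylMatrix A i j = 3) :
    weylGen A i * weylGen A j * weylGen A i = weylGen A j * weylGen A i * weylGen A j :=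
  (mul_pow_three_eq_one_iff_braid (weylGen_sq i) (weylGen_sq j)).1 (h ▸ weylGen_pow i j)

theorem weylGen_braid_four {i j : P} (h : weylMatrix A i j = 4) :
    weylGen A i * weylGen A j * weylGen A i * weylGen A j =
      weylGen A j * weylGen A i * weylGen A j * weylGen A i :=
  (mul_pow_four_eq_one_iff_braid (weylGen_sq i) (weylGen_sq j)).1 (h ▸ weylGen_pow i j)

theorem closure_range_weylGen : Subgroup.closure (Set.range (weylGen A)) = ⊤ :=
  (weylMatrix A).toCoxeterSystem.subgroup_closure_range_simple

end weylGen

/-! ### The generators of the Weyl groups as sequences of types `B` and affine `C` -/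

/-- The generators of the affine Weyl group of type `C_l^{(1)}`, numbered backwards. -/
def affineGenRev (l i : ℕ) : WeylGroup (cartanAffineC l) :=
  weylGen (cartanAffineC l) ⟨l - i, by omega⟩

/-- The generators of the Weyl group of type `C_l`, numbered backwards. -/
def finiteGenRev (l : ℕ) (hl : 2 ≤ l) (i : ℕ) : WeylGroup (CartanMatrix.C l) :=
  weylGen (CartanMatrix.C l) ⟨l - 1 - i, by omega⟩

/-- Backward numbering puts the double bond of the finite diagram at `b 0, b 1`, so that the rank
can grow by appending generators, and makes `b n` the neighbour of `s_0`. -/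
theorem isAffineSequence_affineGenRev {n : ℕ} (hn : 2 ≤ n + 1) :
    IsAffineSequence (weylGen (cartanAffineC (n + 1)) 0) (affineGenRev (n + 1)) n where
  sq i _ := weylGen_sq _
  comm i j hij hj := weylGen_comm <| by
    rw [weylMatrix_cartanAffineC hn]; simp only
    split_ifs <;> first | rfl | omega
  braid i hi := weylGen_braid_three <| by
    rw [weylMatrix_cartanAffineC hn]; simp only
    split_ifs <;> first | rfl | omega
  braid_zero _ := weylGen_braid_four <| by
    rw [weylMatrix_cartanAffineC hn]; simp only
    split_ifs <;> first | rfl | omega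
  pos := by omega
  sq_a := weylGen_sq _
  comm_a i hi := weylGen_comm <| by
    rw [weylMatrix_cartanAffineC hn]; simp only [Fin.val_zero, true_or, if_true, Nat.add_eq_zero_iff,
      one_ne_zero, and_false, or_false]
    split_ifs <;> first | rfl | omega
  braid_a := weylGen_braid_four <| by
    rw [weylMatrix_cartanAffineC hn]; simp only [Fin.val_zero, true_or, if_true, Nat.add_eq_zero_iff,
      one_ne_zero, and_false, or_false]
    split_ifs <;> first | rfl | omega

theorem isTypeBSequence_finiteGenRev {l : ℕ} (hl : 2 ≤ l) :
    IsTypeBSequence (finiteGenRev l hl) l where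
  sq i _ := weylGen_sq _
  comm i j hij hj := weylGen_comm <| by
    rw [weylMatrix_C]; simp only
    split_ifs <;> first | rfl | omega
  braid i hi := weylGen_braid_three <| by
    rw [weylMatrix_C]; simp only
    split_ifs <;> first | rfl | omega
  braid_zero _ := weylGen_braid_four <| by
    rw [weylMatrix_C]; simp only
    split_ifs <;> first | rfl | omega

theorem closure_finiteGenRev {l : ℕ} (hl : 2 ≤ l) :
    Subgroup.closure (finiteGenRev l hl '' Set.Iio l) = ⊤ := by
  rw [← closure_range_weylGen]
  congr 1
  ext w
  constructor
  · rintro ⟨i, _, rfl⟩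
    exact ⟨_, rfl⟩
  · rintro ⟨i, rfl⟩
    exact ⟨l - 1 - i, by simp only [Set.mem_Iio]; omega,
      congrArg (weylGen _) (Fin.ext (by simp only; omega))⟩

theorem closure_affineGenRev (l : ℕ) :
    Subgroup.closure (affineGenRev l '' Set.Iio l) = finiteWeyl l := by
  rw [finiteWeyl]
  congr 1
  ext w
  constructor
  · rintro ⟨i, hi, rfl⟩
    rw [Set.mem_Iio] at hi
    exact ⟨_, fun h => by have := congrArg Fin.val h; simp only [Fin.val_zero] at this; omega, rfl⟩
  · rintro ⟨i, hi, rfl⟩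
    have : i.val ≠ 0 := fun h => hi (Fin.ext h)
    exact ⟨l - i, by simp only [Set.mem_Iio]; omega,
      congrArg (weylGen _) (Fin.ext (by simp only; omega))⟩

theorem closure_insert_affineGenRev (l : ℕ) :
    Subgroup.closure (insert (weylGen (cartanAffineC l) 0) (affineGenRev l '' Set.Iio l)) = ⊤ := by
  rw [eq_top_iff, ← closure_range_weylGen]
  apply Subgroup.closure_mono
  rintro _ ⟨i, rfl⟩
  by_cases hi : i = 0
  · exact Or.inl (by rw [hi])
  · have : i.val ≠ 0 := fun h => hi (Fin.ext h)
    exact Or.inr ⟨l - i, by simp only [Set.mem_Iio]; omega,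
      congrArg (weylGen _) (Fin.ext (by simp only; omega))⟩

/-! ### The action on levels and strings -/

/-- The effect of the generator with label `i` on pairs `(t, s)`. -/
def stringMap (l : ℕ) (hl : 2 ≤ l) (i : Fin (l + 1)) (x : ℤ × SignString l) : ℤ × SignString l :=
  if i.val = 0 then
    (if x.2 ⟨0, Nat.zero_lt_of_lt hl⟩ = true then x.1 + 1 else x.1 - 1,
      Function.update x.2 ⟨0, Nat.zero_lt_of_lt hl⟩ (!(x.2 ⟨0, Nat.zero_lt_of_lt hl⟩)))
  else if h : i.val < l then
    (x.1, x.2 ∘ Equiv.swap ⟨i.val - 1, by omega⟩ ⟨i.val, h⟩)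
  else (x.1, Function.update x.2 ⟨l - 1, by omega⟩ (!(x.2 ⟨l - 1, by omega⟩)))

section stringMap

variable {l : ℕ} (hl : 2 ≤ l)

theorem stringMap_zero {i : Fin (l + 1)} (hi : i.val = 0) (x : ℤ × SignString l) :
    stringMap l hl i x = (if x.2 ⟨0, Nat.zero_lt_of_lt hl⟩ = true then x.1 + 1 else x.1 - 1,
      Function.update x.2 ⟨0, Nat.zero_lt_of_lt hl⟩ (!(x.2 ⟨0, Nat.zero_lt_of_lt hl⟩))) := by
  rw [stringMap, if_pos hi]

theorem stringMap_mid {i : Fin (l + 1)} (h0 : i.val ≠ 0) (h : i.val < l) (x : ℤ × SignString l) :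
    stringMap l hl i x = (x.1, x.2 ∘ Equiv.swap ⟨i.val - 1, by omega⟩ ⟨i.val, h⟩) := by
  rw [stringMap, if_neg h0, dif_pos h]

theorem stringMap_last {i : Fin (l + 1)} (hi : i.val = l) (x : ℤ × SignString l) :
    stringMap l hl i x =
      (x.1, Function.update x.2 ⟨l - 1, by omega⟩ (!(x.2 ⟨l - 1, by omega⟩))) := by
  rw [stringMap, if_neg (by omega), dif_neg (by omega)]

theorem stringMap_involutive (i : Fin (l + 1)) : Function.Involutive (stringMap l hl i) := by
  rintro ⟨t, s⟩
  by_cases h0 : i.val = 0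
  · rw [stringMap_zero hl h0, stringMap_zero hl h0]
    rcases h : s ⟨0, Nat.zero_lt_of_lt hl⟩ <;> simp [h]
  by_cases h1 : i.val < l
  · rw [stringMap_mid hl h0 h1, stringMap_mid hl h0 h1]
    refine Prod.ext rfl (funext fun p => ?_)
    simp
  · rw [stringMap_last hl (by omega), stringMap_last hl (by omega)]
    simp

/-- The permutation by which the generator with label `i` acts on pairs `(t, s)`. -/
def stringPerm (i : Fin (l + 1)) : Equiv.Perm (ℤ × SignString l) :=
  (stringMap_involutive hl i).toPerm

theorem stringPerm_apply (i : Fin (l + 1)) (x : ℤ × SignString l) :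
    stringPerm hl i x = stringMap l hl i x := rfl

theorem stringPerm_sq (i : Fin (l + 1)) : stringPerm hl i * stringPerm hl i = 1 :=
  Equiv.ext (stringMap_involutive hl i)

theorem stringPerm_comm {i j : Fin (l + 1)} (h : i.val + 1 < j.val) :
    stringPerm hl i * stringPerm hl j = stringPerm hl j * stringPerm hl i := by
  ext1 ⟨t, s⟩
  simp only [Equiv.Perm.mul_apply, stringPerm_apply]
  have n1 : (⟨0, Nat.zero_lt_of_lt hl⟩ : Fin l) ≠ ⟨j.val - 1, by omega⟩ := by simp [Fin.ext_iff]; omega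
  by_cases h0 : i.val = 0 <;> by_cases h1 : j.val < l
  · have n2 : (⟨0, Nat.zero_lt_of_lt hl⟩ : Fin l) ≠ ⟨j.val, h1⟩ := by simp [Fin.ext_iff]; omega
    simp only [stringMap_zero hl h0, stringMap_mid hl (by omega : j.val ≠ 0) h1]
    simp only [Function.update_comp_equiv, Function.comp_apply, Equiv.symm_swap,
      Equiv.swap_apply_of_ne_of_ne n1 n2]
  · have n2 : (⟨0, Nat.zero_lt_of_lt hl⟩ : Fin l) ≠ ⟨l - 1, by omega⟩ := by simp [Fin.ext_iff]; omega
    simp only [stringMap_zero hl h0, stringMap_last hl (by omega : j.val = l)]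
    simp only [Function.update_of_ne n2, Function.update_of_ne n2.symm,
      Function.update_comm n2]
  · simp only [stringMap_mid hl h0 (by omega : i.val < l),
      stringMap_mid hl (by omega : j.val ≠ 0) h1]
    have : ∀ p q : Fin l, p.val + 1 < q.val + 1 → p ≠ q := fun p q h => by
      rw [ne_eq, Fin.ext_iff]; omega
    refine Prod.ext rfl (funext fun p => ?_)
    have m1 := this ⟨i.val - 1, by omega⟩ ⟨j.val - 1, by omega⟩ (by simp only; omega)
    have m2 := this ⟨i.val - 1, by omega⟩ ⟨j.val, h1⟩ (by simp only; omega)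
    have m3 := this ⟨i.val, by omega⟩ ⟨j.val - 1, by omega⟩ (by simp only; omega)
    have m4 := this ⟨i.val, by omega⟩ ⟨j.val, h1⟩ (by simp only; omega)
    simp only [Function.comp_apply]
    congr 1
    simp only [Equiv.swap_apply_def]
    grind
  · have n2 : (⟨l - 1, by omega⟩ : Fin l) ≠ ⟨i.val - 1, by omega⟩ := by
      simp [Fin.ext_iff]; omega
    have n3 : (⟨l - 1, by omega⟩ : Fin l) ≠ ⟨i.val, by omega⟩ := by simp [Fin.ext_iff]; omega
    simp only [stringMap_mid hl h0 (by omega : i.val < l),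
      stringMap_last hl (by omega : j.val = l)]
    simp only [Function.update_comp_equiv, Function.comp_apply, Equiv.symm_swap,
      Equiv.swap_apply_of_ne_of_ne n2 n3]

theorem stringPerm_braid_three {i j : Fin (l + 1)} (h : i.val + 1 = j.val) (h0 : i.val ≠ 0)
    (h1 : j.val < l) :
    stringPerm hl i * stringPerm hl j * stringPerm hl i =
      stringPerm hl j * stringPerm hl i * stringPerm hl j := by
  ext1 ⟨t, s⟩
  simp only [Equiv.Perm.mul_apply, stringPerm_apply,
    stringMap_mid hl h0 (by omega : i.val < l), stringMap_mid hl (by omega : j.val ≠ 0) h1]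
  refine Prod.ext rfl (funext fun p => ?_)
  have e : (⟨j.val - 1, by omega⟩ : Fin l) = ⟨i.val, by omega⟩ := Fin.ext (by simp only; omega)
  have n1 : (⟨i.val - 1, by omega⟩ : Fin l) ≠ ⟨i.val, by omega⟩ := by simp [Fin.ext_iff]; omega
  have n2 : (⟨i.val - 1, by omega⟩ : Fin l) ≠ ⟨j.val, h1⟩ := by simp [Fin.ext_iff]; omega
  have n3 : (⟨i.val, by omega⟩ : Fin l) ≠ ⟨j.val, h1⟩ := by simp [Fin.ext_iff]; omega
  simp only [e, Function.comp_apply]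
  generalize (⟨i.val - 1, by omega⟩ : Fin l) = u at *
  generalize (⟨i.val, by omega⟩ : Fin l) = v at *
  generalize (⟨j.val, h1⟩ : Fin l) = w at *
  congr 1
  simp only [Equiv.swap_apply_def]
  grind

theorem stringPerm_braid_four {i j : Fin (l + 1)} (h : i.val + 1 = j.val)
    (h0 : i.val = 0 ∨ j.val = l) :
    stringPerm hl i * stringPerm hl j * stringPerm hl i * stringPerm hl j =
      stringPerm hl j * stringPerm hl i * stringPerm hl j * stringPerm hl i := by
  ext1 ⟨t, s⟩
  simp only [Equiv.Perm.mul_apply, stringPerm_apply]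
  by_cases hi : i.val = 0
  · simp only [stringMap_zero hl hi, stringMap_mid hl (by omega : j.val ≠ 0) (by omega)]
    have e : (⟨j.val - 1, by omega⟩ : Fin l) = ⟨0, Nat.zero_lt_of_lt hl⟩ := Fin.ext (by simp only; omega)
    have n1 : (⟨0, Nat.zero_lt_of_lt hl⟩ : Fin l) ≠ ⟨j.val, by omega⟩ := by simp [Fin.ext_iff]; omega
    rw [e]
    generalize (⟨0, Nat.zero_lt_of_lt hl⟩ : Fin l) = u at *
    generalize (⟨j.val, by omega⟩ : Fin l) = v at *
    simp only [Function.update_comp_equiv, Function.comp_apply, Equiv.symm_swap,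
      Equiv.swap_apply_left, Equiv.swap_apply_right,
      Function.update_of_ne n1.symm]
    refine Prod.ext ?_ (funext fun p => ?_)
    · cases s u <;> cases s v <;> simp
    · simp only [Function.update_apply, Function.comp_apply, Equiv.swap_apply_def]
      grind
  · simp only [stringMap_mid hl hi (by omega : i.val < l),
      stringMap_last hl (by omega : j.val = l)]
    have e : (⟨l - 1, by omega⟩ : Fin l) = ⟨i.val, by omega⟩ := Fin.ext (by simp only; omega)
    have n1 : (⟨i.val - 1, by omega⟩ : Fin l) ≠ ⟨i.val, by omega⟩ := by simp [Fin.ext_iff]; omega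
    rw [e]
    generalize (⟨i.val - 1, by omega⟩ : Fin l) = u at *
    generalize (⟨i.val, by omega⟩ : Fin l) = v at *
    refine Prod.ext rfl (funext fun p => ?_)
    simp only [Function.update_apply, Function.comp_apply, Equiv.swap_apply_def]
    grind

theorem stringPerm_isLiftable : (weylMatrix (cartanAffineC l)).IsLiftable (stringPerm hl) := by
  have key : ∀ i j : Fin (l + 1), i.val < j.val →
      (stringPerm hl i * stringPerm hl j) ^ weylMatrix (cartanAffineC l) i j = 1 := by
    intro i j hij
    have hi := stringPerm_sq hl i
    have hj := stringPerm_sq hl j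
    rw [weylMatrix_cartanAffineC hl]
    split_ifs with h1 h2 h3
    · omega
    · exact (mul_pow_four_eq_one_iff_braid hi hj).2
        (stringPerm_braid_four hl (by omega) (by omega))
    · exact (mul_pow_three_eq_one_iff_braid hi hj).2
        (stringPerm_braid_three hl (by omega) (by omega) (by omega))
    · exact (mul_pow_two_eq_one_iff_comm hi hj).2 (stringPerm_comm hl (by omega))
  intro i j
  rcases lt_trichotomy i.val j.val with h | h | h
  · exact key i j h
  · obtain rfl : i = j := Fin.ext h
    rw [CoxeterMatrix.diagonal, pow_one, stringPerm_sq]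
  · rw [CoxeterMatrix.symmetric]
    exact mul_pow_eq_one_of_swap (stringPerm_sq hl j) (stringPerm_sq hl i) (key j i h)

/-- The action of the affine Weyl group on pairs `(t, s)`. -/
noncomputable def stringAction : WeylGroup (cartanAffineC l) →* Equiv.Perm (ℤ × SignString l) :=
  (weylMatrix (cartanAffineC l)).toCoxeterSystem.lift ⟨stringPerm hl, stringPerm_isLiftable hl⟩

theorem stringAction_weylGen (i : Fin (l + 1)) (x : ℤ × SignString l) :
    stringAction hl (weylGen (cartanAffineC l) i) x = stringMap l hl i x :=
  congrArg (fun σ : Equiv.Perm (ℤ × SignString l) => σ x)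
    ((weylMatrix (cartanAffineC l)).toCoxeterSystem.lift_apply_simple (stringPerm_isLiftable hl) i)

end stringMap

/-- The symbols of a string, numbered backwards and starting with `0`. -/
def revCoord (n : ℕ) (x : ℤ × SignString (n + 1)) (p : ℕ) : Bool :=
  if p ≤ n then x.2 ⟨n - p, by omega⟩ else false

theorem actsAffinely_stringAction {n : ℕ} (hn : 2 ≤ n + 1) :
    ActsAffinely (stringAction hn) (weylGen (cartanAffineC (n + 1)) 0) (affineGenRev (n + 1)) n
      Prod.fst (revCoord n) where
  zero _ x p := by
    rw [affineGenRev, stringAction_weylGen, stringMap_last hn (by simp)]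
    simp only [revCoord, Function.update_apply, Fin.ext_iff]
    by_cases hp : p = 0
    · subst hp; simp
    · rw [if_neg hp]
      split_ifs <;> first | rfl | omega
  succ i hi x p := by
    rw [affineGenRev, stringAction_weylGen,
      stringMap_mid hn (by simp only; omega) (by simp only; omega)]
    -- The reversal `p ↦ n - p` intertwines the two transpositions.
    have hu : ∀ q r : Fin (n + 1), q.val = n - i - 1 → r.val = n - i → ∀ h : p ≤ n,
        Equiv.swap q r ⟨n - p, by omega⟩ = ⟨n - Equiv.swap i (i + 1) p, by omega⟩ := by
      intro q r hq hr hp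
      simp only [Equiv.swap_apply_def, Fin.ext_iff]
      split_ifs <;> simp only [hq, hr] <;> omega
    by_cases hp : p ≤ n
    · have : Equiv.swap i (i + 1) p ≤ n := by
        rw [Equiv.swap_apply_def]; split_ifs <;> omega
      simp only [revCoord, if_pos hp, if_pos this, Function.comp_apply]
      rw [hu _ _ (by simp only; omega) (by simp only; omega) hp]
    · rw [Equiv.swap_apply_of_ne_of_ne (by omega) (by omega), revCoord, revCoord, if_neg hp,
        if_neg hp]
  surj u := by
    refine ⟨(0, fun i => u (n - i)), fun p hp => ?_⟩
    rw [revCoord, if_pos (by omega)]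
    simp only
    congr 1; omega
  level_b i hi x := by
    rw [affineGenRev, stringAction_weylGen]
    by_cases h : i = 0
    · rw [stringMap_last hn (by simp only; omega)]
    · rw [stringMap_mid hn (by simp only; omega) (by simp only; omega)]
  level_a x := by
    rw [stringAction_weylGen, stringMap_zero hn (by simp)]
    simp only [revCoord, le_refl, if_true, Nat.sub_self]
    split_ifs <;> rfl
  coord_a x p := by
    rw [stringAction_weylGen, stringMap_zero hn (by simp)]
    simp only [revCoord, Function.update_apply, Fin.ext_iff]
    by_cases hp : p = n
    · subst hp; simp
    · rw [if_neg hp]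
      split_ifs <;> first | rfl | omega

theorem stringAction_injective {l : ℕ} (hl : 2 ≤ l) : Function.Injective (stringAction hl) := by
  obtain ⟨n, rfl⟩ : ∃ n, l = n + 1 := ⟨l - 1, by omega⟩
  rw [injective_iff_map_eq_one]
  intro g hg
  exact (actsAffinely_stringAction hl).eq_one_of_affine (isAffineSequence_affineGenRev hl)
    (closure_insert_affineGenRev (n + 1)) hg

/-! ### Proper ideals of the heap as lattice paths -/

/-- A lattice path with `l` steps `±1` that starts at an odd integer. -/
structure IsLatticePath (l : ℕ) (f : ℕ → ℤ) : Prop where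
  odd : (2 : ℤ) ∣ f 0 - 1
  step : ∀ p < l, f (p + 1) = f p + 1 ∨ f (p + 1) = f p - 1

namespace IsLatticePath

variable {l : ℕ} {f : ℕ → ℤ} (hf : IsLatticePath l f)
include hf

theorem parity {p : ℕ} (hp : p ≤ l) : (2 : ℤ) ∣ f p - 1 - p := by
  induction p with
  | zero => simpa using hf.odd
  | succ p ih =>
    have := hf.step p hp
    have := ih (by omega)
    push_cast
    omega

theorem le_add {p k : ℕ} (h : p + k ≤ l) : f (p + k) ≤ f p + k ∧ f p ≤ f (p + k) + k := by
  induction k with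
  | zero => simp
  | succ k ih =>
    have := hf.step (p + k) (by omega)
    have := ih (by omega)
    rw [← add_assoc]
    push_cast
    omega

theorem le_abs {p q : ℕ} (hp : p ≤ l) (hq : q ≤ l) : f q ≤ f p + |(p : ℤ) - q| := by
  rcases le_total p q with h | h
  · obtain ⟨k, rfl⟩ := Nat.exists_eq_add_of_le h
    have := (hf.le_add (p := p) (k := k) hq).1
    have : |(p : ℤ) - (p + k : ℕ)| = k := by rw [abs_eq (by omega)]; push_cast; omega
    omega
  · obtain ⟨k, rfl⟩ := Nat.exists_eq_add_of_le h
    have := (hf.le_add (p := q) (k := k) hp).2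
    have : |((q + k : ℕ) : ℤ) - q| = k := by rw [abs_eq (by omega)]; push_cast; omega
    omega

end IsLatticePath

/-- The elements of the heap below a lattice path. -/
def pathIdeal (l : ℕ) (f : ℕ → ℤ) : Set (BinaryHeap l) :=
  {a | a.layer < f a.label.val}

section pathIdeal

variable {l : ℕ} {f g : ℕ → ℤ}

theorem mem_pathIdeal {a : BinaryHeap l} : a ∈ pathIdeal l f ↔ a.layer < f a.label.val := Iff.rfl

theorem pathIdeal_congr (h : ∀ p ≤ l, f p = g p) : pathIdeal l f = pathIdeal l g := by
  ext a
  rw [mem_pathIdeal, mem_pathIdeal, h _ (by omega)]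

namespace IsLatticePath

variable (hf : IsLatticePath l f)
include hf

/-- A path with steps ±1 is 1-Lipschitz, which is exactly what the order of the heap demands. -/
theorem isLowerSet : IsLowerSet (pathIdeal l f) := by
  intro b a hab hb
  rw [mem_pathIdeal] at hb ⊢
  have h1 := BinaryHeap.le_def.1 hab
  have h2 := hf.le_abs (p := a.label.val) (q := b.label.val) (by omega) (by omega)
  omega

/-- The element with label `i` in layer `f i - 1 + 2 * k`. -/
def elt (i : Fin (l + 1)) (k : ℤ) : BinaryHeap l :=
  ⟨i, f i.val - 1 + 2 * k, by have := hf.parity (p := i.val) (by omega); omega⟩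

theorem elt_mem {i : Fin (l + 1)} {k : ℤ} : hf.elt i k ∈ pathIdeal l f ↔ k ≤ 0 := by
  rw [mem_pathIdeal]; simp only [elt]; omega

theorem eq_elt {a : BinaryHeap l} {k : ℤ} (h : a.layer = f a.label.val - 1 + 2 * k) :
    a = hf.elt a.label k := BinaryHeap.ext rfl h

theorem exists_eq_elt (a : BinaryHeap l) : ∃ k, a = hf.elt a.label k := by
  have h1 := hf.parity (p := a.label.val) (by omega)
  have h2 := a.parity
  obtain ⟨k, hk⟩ : (2 : ℤ) ∣ a.layer - (f a.label.val - 1) := by omega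
  exact ⟨k, hf.eq_elt (by omega)⟩

theorem isProperIdeal : IsProperIdeal BinaryHeap.label (pathIdeal l f) where
  isLowerSet := hf.isLowerSet
  empty_ssubset := Set.empty_ssubset.2 ⟨hf.elt 0 0, hf.elt_mem.2 le_rfl⟩
  ssubset_univ := Set.ssubset_univ_iff.2 fun h => by
    have : hf.elt 0 1 ∈ pathIdeal l f := h ▸ Set.mem_univ _
    rw [hf.elt_mem] at this
    omega
  fibre p := by
    refine ⟨Set.empty_ssubset.2 ⟨hf.elt p 0, hf.elt_mem.2 le_rfl, rfl⟩,
      Set.inter_subset_right, fun h => ?_⟩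
    have := (h (a := hf.elt p 1) rfl).1
    rw [hf.elt_mem] at this
    omega

theorem path_eq (p : Fin (l + 1)) : BinaryHeap.path (pathIdeal l f) p = f p.val := by
  have : IsGreatest {y : ℤ | ∃ a ∈ pathIdeal l f, a.label = p ∧ a.layer = y} (f p.val - 1) := by
    refine ⟨⟨hf.elt p 0, hf.elt_mem.2 le_rfl, rfl, by simp [elt]⟩, ?_⟩
    rintro _ ⟨a, ha, rfl, rfl⟩
    rw [mem_pathIdeal] at ha
    omega
  rw [BinaryHeap.path, this.csSup_eq]
  ring

theorem signString_eq : BinaryHeap.signString (pathIdeal l f) =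
    fun i => decide (f i.val < f (i.val + 1)) := by
  ext i
  rw [BinaryHeap.signString, hf.path_eq, hf.path_eq]
  rfl

end IsLatticePath

theorem height_pathIdeal {t : ℤ} (h : f 0 = 2 * t + 1) : BinaryHeap.height (pathIdeal l f) = t := by
  have : IsGreatest {s : ℤ | BinaryHeap.zeroElt l s ∈ pathIdeal l f} t := by
    constructor
    · simp only [Set.mem_ofPred_eq, mem_pathIdeal, BinaryHeap.zeroElt, Fin.val_zero]; omega
    · intro s hs
      simp only [Set.mem_ofPred_eq, mem_pathIdeal, BinaryHeap.zeroElt, Fin.val_zero] at hs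
      omega
  rw [BinaryHeap.height, this.csSup_eq]

theorem shift_image_pathIdeal (k : ℤ) :
    BinaryHeap.shift k '' pathIdeal l f = pathIdeal l fun p => f p + 2 * k := by
  ext a
  constructor
  · rintro ⟨b, hb, rfl⟩
    rw [mem_pathIdeal] at hb ⊢
    simp only [BinaryHeap.shift]
    omega
  · intro ha
    rw [mem_pathIdeal] at ha
    refine ⟨BinaryHeap.shift (-k) a, ?_, ?_⟩
    · rw [mem_pathIdeal]; simp only [BinaryHeap.shift]; omega
    · ext
      · rfl
      · simp [BinaryHeap.shift]

/-! ### Removing and adding elements -/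

/-- The path has a strict local maximum (for `e = 1`) or minimum (for `e = -1`) at `i`. -/
def IsLocalPeak (l : ℕ) (f : ℕ → ℤ) (i : ℕ) (e : ℤ) : Prop :=
  (0 < i → f (i - 1) = f i - e) ∧ (i < l → f (i + 1) = f i - e)

namespace IsLatticePath

variable (hf : IsLatticePath l f)
include hf

theorem update {i : ℕ} {e : ℤ} (h : IsLocalPeak l f i e) :
    IsLatticePath l (Function.update f i (f i - 2 * e)) := by
  constructor
  · have := hf.odd
    rw [Function.update_apply]
    split_ifs with h0
    · subst h0; omega
    · exact this
  · intro p hp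
    have hs := hf.step p hp
    obtain ⟨h1, h2⟩ := h
    simp only [Function.update_apply]
    split_ifs with h3 h4 h4
    · omega
    · have := h1 (by omega)
      rw [← h3, Nat.add_sub_cancel] at this
      rw [h3] at this hs
      omega
    · subst h4
      have := h2 hp
      omega
    · exact hs

theorem isLocalPeak_of_ne {i : Fin (l + 1)} {e : ℤ} (he : e = 1 ∨ e = -1)
    (h : ∀ q : Fin (l + 1), |(i.val : ℤ) - q.val| = 1 → f q.val ≠ f i.val + e) :
    IsLocalPeak l f i.val e := by
  constructor
  · intro hi
    have h1 := hf.step (i.val - 1) (by omega)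
    have h2 := h ⟨i.val - 1, by omega⟩ (by rw [abs_eq zero_le_one]; push_cast; omega)
    have e1 : i.val - 1 + 1 = i.val := by omega
    simp only [e1] at h1 h2
    omega
  · intro hi
    have h1 := hf.step i.val hi
    have h2 := h ⟨i.val + 1, by omega⟩ (by rw [abs_eq zero_le_one]; push_cast; omega)
    simp only at h2
    omega

theorem diff_elt (i : Fin (l + 1)) :
    pathIdeal l f \ {hf.elt i 0} = pathIdeal l (Function.update f i.val (f i.val - 2)) := by
  ext a
  obtain ⟨k, hk⟩ := hf.exists_eq_elt a
  have hl := congrArg BinaryHeap.layer hk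
  simp only [elt] at hl
  simp only [Set.mem_sdiff, Set.mem_singleton_iff, mem_pathIdeal, Function.update_apply,
    BinaryHeap.ext_iff, elt]
  by_cases h : a.label = i
  · rw [if_pos (congrArg Fin.val h)]
    subst h
    simp only [true_and]
    omega
  · have h' : ¬ a.label.val = i.val := fun e => h (Fin.ext e)
    simp only [h, h', false_and, not_false_eq_true, and_true, if_false]

theorem union_elt (i : Fin (l + 1)) :
    pathIdeal l f ∪ {hf.elt i 1} = pathIdeal l (Function.update f i.val (f i.val + 2)) := by
  ext a
  obtain ⟨k, hk⟩ := hf.exists_eq_elt a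
  have hl := congrArg BinaryHeap.layer hk
  simp only [elt] at hl
  simp only [Set.mem_union, Set.mem_singleton_iff, mem_pathIdeal, Function.update_apply,
    BinaryHeap.ext_iff, elt]
  by_cases h : a.label = i
  · rw [if_pos (congrArg Fin.val h)]
    subst h
    simp only [true_and]
    omega
  · have h' : ¬ a.label.val = i.val := fun e => h (Fin.ext e)
    simp only [h, h', false_and, or_false, if_false]

/-- A removable element is maximal in the ideal. So it is the top of its column, and no neighbouring
column may be higher. Conversely, lowering a peak by two gives a lattice path again. -/
theorem mem_removable {i : Fin (l + 1)} {a : BinaryHeap l} :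
    a ∈ removable BinaryHeap.label i (pathIdeal l f) ↔
      a = hf.elt i 0 ∧ IsLocalPeak l f i.val 1 := by
  constructor
  · rintro ⟨rfl, ha, hlow⟩
    obtain ⟨k, hk⟩ := hf.exists_eq_elt a
    have hno : ∀ b ∈ pathIdeal l f, a ≤ b → b = a := fun b hb hab => by
      by_contra hne
      exact (hlow hab ⟨hb, hne⟩).2 rfl
    have hk0 : k ≤ 0 := by rw [hk, hf.elt_mem] at ha; exact ha
    have hk1 : k = 0 := by
      have := hno (hf.elt a.label 0) (hf.elt_mem.2 le_rfl) <| by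
        have := congrArg BinaryHeap.layer hk
        rw [BinaryHeap.le_def]
        simp only [elt] at this ⊢
        simp only [sub_self, abs_zero]
        omega
      rw [hk] at this
      have := congrArg BinaryHeap.layer this
      simp only [elt] at this
      omega
    rw [hk1] at hk
    -- A higher neighbouring column would have its top element above `a`.
    refine ⟨hk, hf.isLocalPeak_of_ne (Or.inl rfl) fun q hq hfq => ?_⟩
    have := hno (hf.elt q 0) (hf.elt_mem.2 le_rfl) <| by
      have := congrArg BinaryHeap.layer hk
      rw [BinaryHeap.le_def]
      simp only [elt] at this ⊢
      omega
    have := congrArg BinaryHeap.label this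
    simp only [elt] at this
    rw [this] at hq
    simp at hq
  · rintro ⟨rfl, h⟩
    refine ⟨rfl, hf.elt_mem.2 le_rfl, ?_⟩
    rw [hf.diff_elt]
    exact (hf.update h).isLowerSet

theorem mem_addable {i : Fin (l + 1)} {a : BinaryHeap l} :
    a ∈ addable BinaryHeap.label i (pathIdeal l f) ↔
      a = hf.elt i 1 ∧ IsLocalPeak l f i.val (-1) := by
  constructor
  · rintro ⟨rfl, ha, hlow⟩
    obtain ⟨k, hk⟩ := hf.exists_eq_elt a
    have hno : ∀ b ∉ pathIdeal l f, b ≤ a → b = a := fun b hb hab => by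
      rcases hlow hab (Or.inr rfl) with h | h
      · exact absurd h hb
      · exact h
    have hk0 : ¬ k ≤ 0 := by rw [hk, hf.elt_mem] at ha; exact ha
    have hk1 : k = 1 := by
      have := hno (hf.elt a.label 1) (by rw [hf.elt_mem]; omega) <| by
        have := congrArg BinaryHeap.layer hk
        rw [BinaryHeap.le_def]
        simp only [elt] at this ⊢
        simp only [sub_self, abs_zero]
        omega
      rw [hk] at this
      have := congrArg BinaryHeap.layer this
      simp only [elt] at this
      omega
    rw [hk1] at hk
    refine ⟨hk, hf.isLocalPeak_of_ne (Or.inr rfl) fun q hq hfq => ?_⟩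
    have := hno (hf.elt q 1) (by rw [hf.elt_mem]; omega) <| by
      have := congrArg BinaryHeap.layer hk
      rw [BinaryHeap.le_def]
      rw [abs_sub_comm] at hq
      simp only [elt] at this ⊢
      omega
    have := congrArg BinaryHeap.label this
    simp only [elt] at this
    rw [this] at hq
    simp at hq
  · rintro ⟨rfl, h⟩
    refine ⟨rfl, by rw [hf.elt_mem]; omega, ?_⟩
    rw [hf.union_elt]
    have := (hf.update h).isLowerSet
    rwa [show f i.val - 2 * (-1) = f i.val + 2 by ring] at this

theorem heapReflection_of_max {i : Fin (l + 1)} (h : IsLocalPeak l f i.val 1) :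
    heapReflection BinaryHeap.label i (pathIdeal l f) =
      pathIdeal l (Function.update f i.val (f i.val - 2)) := by
  have : removable BinaryHeap.label i (pathIdeal l f) = {hf.elt i 0} := by
    ext a; simp [hf.mem_removable, h]
  rw [heapReflection, this, if_pos (Set.singleton_nonempty _), hf.diff_elt]

/-- Removal has priority over addition, hence the second hypothesis; the two peak conditions exclude
each other as soon as `i` has a neighbour. -/
theorem heapReflection_of_min {i : Fin (l + 1)} (h : IsLocalPeak l f i.val (-1))
    (h' : ¬ IsLocalPeak l f i.val 1) :
    heapReflection BinaryHeap.label i (pathIdeal l f) =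
      pathIdeal l (Function.update f i.val (f i.val + 2)) := by
  have h1 : removable BinaryHeap.label i (pathIdeal l f) = ∅ := by
    ext a; simp [hf.mem_removable, h']
  have h2 : addable BinaryHeap.label i (pathIdeal l f) = {hf.elt i 1} := by
    ext a; simp [hf.mem_addable, h]
  rw [heapReflection, h1, if_neg Set.not_nonempty_empty, h2, hf.union_elt]

theorem heapReflection_of_not {i : Fin (l + 1)} (h : ¬ IsLocalPeak l f i.val (-1))
    (h' : ¬ IsLocalPeak l f i.val 1) :
    heapReflection BinaryHeap.label i (pathIdeal l f) = pathIdeal l f := by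
  have h1 : removable BinaryHeap.label i (pathIdeal l f) = ∅ := by
    ext a; simp [hf.mem_removable, h']
  have h2 : addable BinaryHeap.label i (pathIdeal l f) = ∅ := by
    ext a; simp [hf.mem_addable, h]
  rw [heapReflection, h1, if_neg Set.not_nonempty_empty, h2, Set.union_empty]

end IsLatticePath

end pathIdeal

/-! ### The path of a pair `(t, s)` -/

/-- The lattice path that starts at `2 t + 1` and has the steps given by the string `s`. -/
def stringPath {l : ℕ} (x : ℤ × SignString l) : ℕ → ℤ
  | 0 => 2 * x.1 + 1
  | p + 1 => stringPath x p + if h : p < l then (if x.2 ⟨p, h⟩ = true then 1 else -1) else 0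

section stringPath

variable {l : ℕ}

theorem stringPath_succ (x : ℤ × SignString l) {p : ℕ} (hp : p < l) :
    stringPath x (p + 1) = stringPath x p + if x.2 ⟨p, hp⟩ = true then 1 else -1 := by
  rw [stringPath, dif_pos hp]

theorem isLatticePath_stringPath (x : ℤ × SignString l) : IsLatticePath l (stringPath x) where
  odd := by simp [stringPath]
  step p hp := by
    rw [stringPath_succ x hp]
    split_ifs <;> omega

theorem pathIdeal_eq_of_step {f : ℕ → ℤ} {x : ℤ × SignString l} (h0 : f 0 = 2 * x.1 + 1)
    (hs : ∀ p (hp : p < l), f (p + 1) = f p + if x.2 ⟨p, hp⟩ = true then 1 else -1) :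
    pathIdeal l f = pathIdeal l (stringPath x) := by
  refine pathIdeal_congr fun p hp => ?_
  induction p with
  | zero => exact h0
  | succ p ih => rw [hs p hp, stringPath_succ x hp, ih (by omega)]

theorem coords_pathIdeal (x : ℤ × SignString l) :
    BinaryHeap.coords (pathIdeal l (stringPath x)) = x := by
  have hx := isLatticePath_stringPath x
  have hh : BinaryHeap.height (pathIdeal l (stringPath x)) = x.1 := height_pathIdeal rfl
  have hy : IsLatticePath l fun p => stringPath x p + 2 * -x.1 :=
    ⟨by have := hx.odd; omega, fun p hp => by have := hx.step p hp; omega⟩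
  rw [BinaryHeap.coords, hh, shift_image_pathIdeal, hy.signString_eq]
  refine Prod.ext rfl (funext fun i => ?_)
  simp only [stringPath_succ x i.isLt]
  cases x.2 i <;> simp

/-- Properness gives every column a top element, and the ideal is the set of elements below these
tops. Adjacent tops differ by at most one layer because the ideal is a lower set, and by exactly one
because of parity. -/
theorem exists_stringPath {I : Set (BinaryHeap l)} (hI : IsProperIdeal BinaryHeap.label I) :
    ∃ x : ℤ × SignString l, I = pathIdeal l (stringPath x) := by
  have hmax : ∀ p : Fin (l + 1), ∃ b ∈ I, b.label = p ∧
      ∀ a ∈ I, a.label = p → a.layer ≤ b.layer := by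
    intro p
    obtain ⟨⟨a, ha, hap⟩, -⟩ := Set.empty_ssubset.1 (hI.fibre p).1, trivial
    obtain ⟨c, hc, hcI⟩ := Set.exists_of_ssubset (hI.fibre p).2
    have hc' : c.label = p := hc
    have hb : ∀ y : ℤ, (∃ b ∈ I, b.label = p ∧ b.layer = y) → y ≤ c.layer := by
      rintro _ ⟨b, hb, hbp, rfl⟩
      by_contra hlt
      refine hcI ⟨hI.isLowerSet ?_ hb, hc⟩
      rw [BinaryHeap.le_def, hc', hbp, sub_self, abs_zero]
      omega
    obtain ⟨_, ⟨b, hbI, hbp, rfl⟩, hbmax⟩ :=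
      Int.exists_greatest_of_bdd ⟨c.layer, hb⟩ ⟨_, a, ha, hap, rfl⟩
    exact ⟨b, hbI, hbp, fun a ha hap => hbmax _ ⟨a, ha, hap, rfl⟩⟩
  choose b hbI hbl hbmax using hmax
  have hstep : ∀ p q : Fin (l + 1), |(p.val : ℤ) - q.val| = 1 →
      (b p).layer - 1 ≤ (b q).layer := by
    intro p q hpq
    have hp := (b p).parity
    rw [hbl p] at hp
    have hpq' := (abs_eq zero_le_one).1 hpq
    -- The element with label `q` just below the top of column `p` lies in the ideal.
    refine hbmax q ⟨q, (b p).layer - 1, by omega⟩ (hI.isLowerSet ?_ (hbI p)) rfl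
    rw [BinaryHeap.le_def, hbl p, abs_sub_comm, hpq]
    simp
  let f : ℕ → ℤ := fun p => if h : p < l + 1 then (b ⟨p, h⟩).layer + 1 else 0
  have hf : ∀ p : Fin (l + 1), f p.val = (b p).layer + 1 := fun p => dif_pos p.isLt
  have hIf : I = pathIdeal l f := by
    ext a
    rw [mem_pathIdeal, hf]
    constructor
    · intro ha
      have := hbmax _ a ha rfl
      omega
    · intro ha
      refine hI.isLowerSet ?_ (hbI a.label)
      rw [BinaryHeap.le_def, hbl, sub_self, abs_zero]
      omega
  refine ⟨((f 0 - 1) / 2, fun i => decide (f i.val < f (i.val + 1))), ?_⟩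
  rw [hIf]
  apply pathIdeal_eq_of_step
  · have h1 := (b 0).parity
    have h2 := hf 0
    rw [hbl 0] at h1
    simp only [Fin.val_zero] at h1 h2 ⊢
    omega
  · intro p hp
    have e1 := hf ⟨p, by omega⟩
    have e2 := hf ⟨p + 1, by omega⟩
    have h1 := hstep ⟨p, by omega⟩ ⟨p + 1, by omega⟩
      (by rw [abs_eq zero_le_one]; push_cast; omega)
    have h2 := hstep ⟨p + 1, by omega⟩ ⟨p, by omega⟩
      (by rw [abs_eq zero_le_one]; push_cast; omega)
    have p1 := (b ⟨p, by omega⟩).parity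
    have p2 := (b ⟨p + 1, by omega⟩).parity
    rw [hbl] at p1 p2
    simp only at e1 e2 p1 p2
    simp only [decide_eq_true_eq]
    push_cast at p1 p2
    split_ifs <;> omega

/-- The parametrization of the proper ideals by pairs `(t, s)`. -/
noncomputable def properIdealEquiv (l : ℕ) : ℤ × SignString l ≃
    ProperIdeal (BinaryHeap.label : BinaryHeap l → Fin (l + 1)) where
  toFun x := ⟨pathIdeal l (stringPath x), (isLatticePath_stringPath x).isProperIdeal⟩
  invFun I := BinaryHeap.coords I.val
  left_inv x := coords_pathIdeal x
  right_inv I := by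
    obtain ⟨x, hx⟩ := exists_stringPath I.2
    refine Subtype.ext ?_
    simp only [hx, coords_pathIdeal]

theorem isLocalPeak_stringPath (x : ℤ × SignString l) {i : ℕ} (hi : i ≤ l) {e : ℤ} :
    IsLocalPeak l (stringPath x) i e ↔
      (∀ h : 0 < i, (if x.2 ⟨i - 1, by omega⟩ = true then 1 else -1) = e) ∧
      ∀ h : i < l, (if x.2 ⟨i, h⟩ = true then 1 else -1) = -e := by
  refine and_congr (forall_congr' fun h => ?_) (forall_congr' fun h => ?_)
  · obtain ⟨j, rfl⟩ : ∃ j, i = j + 1 := ⟨i - 1, by omega⟩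
    rw [stringPath_succ x (p := j) (by omega)]
    simp only [Nat.add_sub_cancel]
    omega
  · rw [stringPath_succ x h]
    omega

/-- Changing the value at `i` by `c` adds `c` to the step into `i` and subtracts it from the step
out of `i`; for `i = 0` it moves the starting value instead of an incoming step. -/
theorem pathIdeal_update_stringPath {x y : ℤ × SignString l} {i : ℕ} {c : ℤ}
    (h0 : (if i = 0 then c else 0) = 2 * y.1 - 2 * x.1)
    (hs : ∀ p (hp : p < l), (if y.2 ⟨p, hp⟩ = true then (1 : ℤ) else -1) =
      (if x.2 ⟨p, hp⟩ = true then 1 else -1) + (if p + 1 = i then c else 0) -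
        if p = i then c else 0) :
    pathIdeal l (Function.update (stringPath x) i (stringPath x i + c)) =
      pathIdeal l (stringPath y) := by
  apply pathIdeal_eq_of_step
  · rw [Function.update_apply]
    split_ifs with h
    · subst h
      rw [if_pos rfl] at h0
      simp only [stringPath]; omega
    · rw [if_neg (Ne.symm h)] at h0
      simp only [stringPath]; omega
  · intro p hp
    rw [hs p hp]
    have := stringPath_succ x hp
    simp only [Function.update_apply]
    by_cases h1 : p + 1 = i
    · subst h1
      simp only [if_true, Nat.left_eq_add, one_ne_zero, if_false]
      omega
    · by_cases h2 : p = i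
      · subst h2
        simp only [Nat.add_eq_left, one_ne_zero, if_true, if_false]
        omega
      · simp only [h1, h2, if_false]
        omega

theorem heapReflection_pathIdeal (hl : 2 ≤ l) (i : Fin (l + 1)) (x : ℤ × SignString l) :
    heapReflection BinaryHeap.label i (pathIdeal l (stringPath x)) =
      pathIdeal l (stringPath (stringMap l hl i x)) := by
  have hx := isLatticePath_stringPath x
  have hpk : ∀ e, _ := fun e => isLocalPeak_stringPath x (i := i.val) (by omega) (e := e)
  obtain ⟨t, s⟩ := x
  by_cases h0 : i.val = 0
  · rw [stringMap_zero hl h0]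
    simp only [h0, lt_self_iff_false, IsEmpty.forall_iff, true_and, (Nat.zero_lt_of_lt hl : 0 < l)] at hpk
    cases hs : s ⟨0, Nat.zero_lt_of_lt hl⟩
    · rw [hx.heapReflection_of_max (by rw [h0, hpk]; simp [hs]), sub_eq_add_neg]
      refine pathIdeal_update_stringPath (by simp [h0, hs]; ring) fun p hp => ?_
      by_cases hp0 : p = 0
      · subst hp0; simp [h0, hs]
      · simp [h0, hp0]
    · rw [hx.heapReflection_of_min (by rw [h0, hpk]; simp [hs]) (by rw [h0, hpk]; simp [hs])]
      refine pathIdeal_update_stringPath (by simp [h0, hs]; ring) fun p hp => ?_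
      by_cases hp0 : p = 0
      · subst hp0; simp [h0, hs]
      · simp [h0, hp0]
  by_cases h1 : i.val < l
  · rw [stringMap_mid hl h0 h1]
    simp only [h1, Nat.pos_of_ne_zero h0] at hpk
    -- Exchanging two adjacent steps changes the path only at the vertex between them, by the
    -- difference `c` of the steps: `2` at a minimum, `-2` at a maximum, `0` for equal symbols.
    have step : ∀ c : ℤ, (if s ⟨i.val, h1⟩ = true then (1 : ℤ) else -1) =
        (if s ⟨i.val - 1, by omega⟩ = true then 1 else -1) + c →
        ∀ p (hp : p < l), (if (s ∘ Equiv.swap (⟨i.val - 1, by omega⟩ : Fin l) ⟨i.val, h1⟩) ⟨p, hp⟩ =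
          true then (1 : ℤ) else -1) = (if s ⟨p, hp⟩ = true then 1 else -1) +
            (if p + 1 = i.val then c else 0) - if p = i.val then c else 0 := by
      intro c hc p hp
      by_cases e1 : p + 1 = i.val
      · have : (⟨i.val - 1, by omega⟩ : Fin l) = ⟨p, hp⟩ := Fin.ext (by simp only; omega)
        rw [this] at hc ⊢
        rw [Function.comp_apply, Equiv.swap_apply_left, hc, if_pos e1,
          if_neg (by omega : ¬ p = i.val), sub_zero]
      · by_cases e2 : p = i.val
        · subst e2
          rw [Function.comp_apply, Equiv.swap_apply_right, if_neg e1, if_pos rfl, hc]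
          ring
        · rw [Function.comp_apply, Equiv.swap_apply_of_ne_of_ne
            (by rw [ne_eq, Fin.mk.injEq]; omega) (by rw [ne_eq, Fin.mk.injEq]; omega),
            if_neg e1, if_neg e2, add_zero, sub_zero]
    cases hs : s ⟨i.val - 1, by omega⟩ <;> cases hs' : s ⟨i.val, h1⟩
    · rw [hx.heapReflection_of_not (by rw [hpk]; simp [hs, hs']) (by rw [hpk]; simp [hs, hs'])]
      have := step 0 (by simp [hs, hs'])
      exact pathIdeal_eq_of_step rfl fun p hp => by
        rw [stringPath_succ _ hp, this p hp]; simp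
    · rw [hx.heapReflection_of_min (by rw [hpk]; simp [hs, hs']) (by rw [hpk]; simp [hs, hs'])]
      exact pathIdeal_update_stringPath (by simp [h0]) (step 2 (by simp [hs, hs']))
    · rw [hx.heapReflection_of_max (by rw [hpk]; simp [hs, hs']), sub_eq_add_neg]
      exact pathIdeal_update_stringPath (by simp [h0]) (step (-2) (by simp [hs, hs']))
    · rw [hx.heapReflection_of_not (by rw [hpk]; simp [hs, hs']) (by rw [hpk]; simp [hs, hs'])]
      have := step 0 (by simp [hs, hs'])
      exact pathIdeal_eq_of_step rfl fun p hp => by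
        rw [stringPath_succ _ hp, this p hp]; simp
  · have hil : i.val = l := by omega
    rw [stringMap_last hl hil]
    simp only [hil, lt_self_iff_false, IsEmpty.forall_iff, and_true, (Nat.zero_lt_of_lt hl : 0 < l)] at hpk
    have e1 : ∀ p, p + 1 = l ↔ p = l - 1 := by omega
    cases hs : s ⟨l - 1, by omega⟩
    · rw [hx.heapReflection_of_min (by rw [hil, hpk]; simp [hs]) (by rw [hil, hpk]; simp [hs])]
      refine pathIdeal_update_stringPath (by simp [h0]) fun p hp => ?_
      by_cases hp0 : p = l - 1
      · subst hp0; simp [hil, hs, e1, hp.ne]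
      · simp [hil, hp0, hp.ne, e1]
    · rw [hx.heapReflection_of_max (by rw [hil, hpk]; simp [hs]), sub_eq_add_neg]
      refine pathIdeal_update_stringPath (by simp [h0]) fun p hp => ?_
      by_cases hp0 : p = l - 1
      · subst hp0; simp [hil, hs, e1, hp.ne]
      · simp [hil, hp0, hp.ne, e1]

end stringPath

/-! ### The finite Weyl group and its action on strings -/

section finiteWeyl

variable {l : ℕ} (hl : 2 ≤ l)

theorem stringAction_finiteGen (j : Fin l) (x : ℤ × SignString l) :
    stringAction hl (finiteGen l j) x = stringMap l hl j.succ x :=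
  stringAction_weylGen hl j.succ x

theorem exists_stringAction_eq {w : WeylGroup (cartanAffineC l)} (hw : w ∈ finiteWeyl l) :
    ∃ σ : Equiv.Perm (SignString l), ∀ t s, stringAction hl w (t, s) = (t, σ s) := by
  induction hw using Subgroup.closure_induction with
  | mem w hw =>
    obtain ⟨i, hi, rfl⟩ := hw
    have h0 : i.val ≠ 0 := fun h => hi (Fin.ext h)
    have key : ∀ t s, stringMap l hl i (t, s) = (t, (stringMap l hl i (0, s)).2) := by
      intro t s
      by_cases h : i.val < l
      · rw [stringMap_mid hl h0 h, stringMap_mid hl h0 h]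
      · rw [stringMap_last hl (by omega), stringMap_last hl (by omega)]
    have hinv : Function.Involutive fun s => (stringMap l hl i (0, s)).2 := fun s => by
      have h := stringMap_involutive hl i (0, s)
      rw [key 0 s] at h
      exact congrArg Prod.snd h
    exact ⟨hinv.toPerm, fun t s => by rw [stringAction_weylGen, key]; rfl⟩
  | one => exact ⟨1, fun t s => by simp⟩
  | mul w w' _ _ hw hw' =>
    obtain ⟨σ, hσ⟩ := hw
    obtain ⟨τ, hτ⟩ := hw'
    exact ⟨σ * τ, fun t s => by rw [map_mul, Equiv.Perm.mul_apply, hτ, hσ]; rfl⟩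
  | inv w _ hw =>
    obtain ⟨σ, hσ⟩ := hw
    refine ⟨σ⁻¹, fun t s => ?_⟩
    rw [map_inv, Equiv.Perm.inv_eq_iff_eq, hσ, ← Equiv.Perm.mul_apply, mul_inv_cancel,
      Equiv.Perm.one_apply]

/-- The action of `W₀` on strings. -/
noncomputable def finiteStringAction : finiteWeyl l →* Equiv.Perm (SignString l) :=
  MonoidHom.mk' (fun w => (exists_stringAction_eq hl w.2).choose) fun w w' => by
    ext1 s
    have h := (exists_stringAction_eq hl (w * w').2).choose_spec 0 s
    have e : stringAction hl (w * w' : finiteWeyl l) =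
      stringAction hl w * stringAction hl w' := map_mul _ _ _
    rw [DFunLike.congr_fun e, Equiv.Perm.mul_apply,
      (exists_stringAction_eq hl w'.2).choose_spec,
      (exists_stringAction_eq hl w.2).choose_spec] at h
    exact (congrArg Prod.snd h).symm

theorem stringAction_coe (w : finiteWeyl l) (t : ℤ) (s : SignString l) :
    stringAction hl w (t, s) = (t, finiteStringAction hl w s) :=
  (exists_stringAction_eq hl w.2).choose_spec t s

theorem finiteStringAction_apply (w : finiteWeyl l) (s : SignString l) :
    finiteStringAction hl w s = (stringAction hl w (0, s)).2 := by
  rw [stringAction_coe]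

theorem finiteStringAction_injective : Function.Injective (finiteStringAction hl) := by
  intro w w' h
  refine Subtype.ext (stringAction_injective hl (Equiv.ext fun x => ?_))
  obtain ⟨t, s⟩ := x
  rw [stringAction_coe, stringAction_coe, h]

/-- Each flip alters a single symbol and belongs to `W₀`, so the symbols can be corrected one at a
time. -/
theorem finiteStringAction_transitive (s s' : SignString l) :
    ∃ w, finiteStringAction hl w s = s' := by
  obtain ⟨n, rfl⟩ : ∃ n, l = n + 1 := ⟨l - 1, by omega⟩
  have hact := actsAffinely_stringAction hl
  have key : ∀ m ≤ n + 1, ∃ w ∈ finiteWeyl (n + 1), ∀ p < m,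
      revCoord n (stringAction hl w (0, s)) p = revCoord n (0, s') p := by
    intro m hm
    induction m with
    | zero => exact ⟨1, one_mem _, fun p hp => absurd hp (Nat.not_lt_zero p)⟩
    | succ m ih =>
      obtain ⟨w, hw, h⟩ := ih (by omega)
      by_cases hc : revCoord n (stringAction hl w (0, s)) m = revCoord n (0, s') m
      · refine ⟨w, hw, fun p hp => ?_⟩
        rcases (Nat.lt_succ_iff.1 hp).eq_or_lt with rfl | hp
        exacts [hc, h p hp]
      · have hmem : flipElt (affineGenRev (n + 1)) m ∈ finiteWeyl (n + 1) := by
          rw [← closure_affineGenRev]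
          exact Subgroup.closure_mono (Set.image_mono (Set.Iio_subset_Iio hm))
            (cosetRep_mem _ le_rfl)
        refine ⟨_, mul_mem hmem hw, fun p hp => ?_⟩
        rw [map_mul, Equiv.Perm.mul_apply, hact.flipElt (by omega)]
        rcases (Nat.lt_succ_iff.1 hp).eq_or_lt with rfl | hp
        · rw [if_pos rfl]
          cases h1 : revCoord n (stringAction hl w (0, s)) p <;>
            cases h2 : revCoord n (0, s') p <;> simp_all
        · rw [if_neg hp.ne, h p hp]
  obtain ⟨w, hw, h⟩ := key (n + 1) le_rfl
  refine ⟨⟨w, hw⟩, funext fun i => ?_⟩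
  have hi := h (n - i.val) (by omega)
  have e : (⟨n - (n - i.val), by omega⟩ : Fin (n + 1)) = i := Fin.ext (by simp only; omega)
  simp only [revCoord, Nat.sub_le, if_true, e] at hi
  rw [finiteStringAction_apply, hi]

/-- The homomorphism from the Weyl group of type `C_l` to the affine Weyl group. -/
noncomputable def finiteWeylHom : WeylGroup (CartanMatrix.C l) →* finiteWeyl l :=
  (weylMatrix (CartanMatrix.C l)).toCoxeterSystem.lift ⟨finiteGen l, fun i j => by
    rw [weylMatrix_C_eq hl]
    exact Subtype.ext (weylGen_pow i.succ j.succ)⟩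

theorem finiteWeylHom_weylGen (j : Fin l) :
    finiteWeylHom hl (weylGen (CartanMatrix.C l) j) = finiteGen l j :=
  (weylMatrix (CartanMatrix.C l)).toCoxeterSystem.lift_apply_simple _ j

theorem finiteWeylHom_finiteGenRev {i : ℕ} (hi : i < l) :
    (finiteWeylHom hl (finiteGenRev l hl i) : WeylGroup (cartanAffineC l)) = affineGenRev l i := by
  rw [finiteGenRev, finiteWeylHom_weylGen]
  exact congrArg (weylGen _) (Fin.ext (by simp only [Fin.succ_mk]; omega))

theorem finiteWeylHom_surjective : Function.Surjective (finiteWeylHom hl) := by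
  rintro ⟨w, hw⟩
  have : finiteWeyl l ≤ ((finiteWeyl l).subtype.comp (finiteWeylHom hl)).range := by
    conv_lhs => rw [← closure_affineGenRev]
    rw [Subgroup.closure_le]
    rintro _ ⟨i, hi, rfl⟩
    exact ⟨finiteGenRev l hl i, finiteWeylHom_finiteGenRev hl hi⟩
  obtain ⟨v, hv⟩ := this hw
  exact ⟨v, Subtype.ext hv⟩

/-- The action on pairs pulled back to the presented group of type `C_l` satisfies the type B
hypotheses, so that group already acts faithfully; the map it acts through is therefore injective.
-/
theorem finiteWeylHom_injective : Function.Injective (finiteWeylHom hl) := by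
  rw [injective_iff_map_eq_one]
  intro g hg
  obtain ⟨n, rfl⟩ : ∃ n, l = n + 1 := ⟨l - 1, by omega⟩
  have hact := actsAffinely_stringAction hl
  let π : WeylGroup (CartanMatrix.C (n + 1)) →* Equiv.Perm (ℤ × SignString (n + 1)) :=
    (stringAction hl).comp ((finiteWeyl (n + 1)).subtype.comp (finiteWeylHom hl))
  have hgen : ∀ i < n + 1, π (finiteGenRev (n + 1) hl i) =
      stringAction hl (affineGenRev (n + 1) i) := fun i hi =>
    congrArg (stringAction hl) (finiteWeylHom_finiteGenRev hl hi)
  have hπ : ActsOnCoords π (finiteGenRev (n + 1) hl) (n + 1) (revCoord n) :=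
    { zero := fun h0 x p => by rw [hgen 0 h0]; exact hact.zero h0 x p
      succ := fun i hi x p => by rw [hgen _ hi]; exact hact.succ i hi x p
      surj := hact.surj }
  refine hπ.eq_one (isTypeBSequence_finiteGenRev hl) le_rfl
    (closure_finiteGenRev hl ▸ Subgroup.mem_top g) fun x p _ => ?_
  have : π g = 1 := by simp [π, hg]
  rw [this, Equiv.Perm.one_apply]

end finiteWeyl

theorem finite_finiteWeyl {l : ℕ} (hl : 2 ≤ l) : Finite (finiteWeyl l) :=
  Finite.of_injective _ (finiteStringAction_injective hl)

/-! ### Transport of the action to proper ideals. -/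

theorem proposition8p7 (l : ℕ) (hl : 2 ≤ l) :
    -- the subgroup `W₀` is a finite Weyl group of type `C_l`
    Finite (finiteWeyl l) ∧
    (∃ e : WeylGroup (CartanMatrix.C l) ≃* finiteWeyl l,
      ∀ j : Fin l, e (weylGen (CartanMatrix.C l) j) = finiteGen l j) ∧
    -- the action `ρ` of `W` on proper ideals
    ∃ ρ : WeylGroup (cartanAffineC l) →*
        Equiv.Perm (ProperIdeal (BinaryHeap.label : BinaryHeap l → Fin (l + 1))),
      (∀ (i : Fin (l + 1)) (I : ProperIdeal (BinaryHeap.label : BinaryHeap l → Fin (l + 1))),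
        (ρ (weylGen (cartanAffineC l) i) I).val = heapReflection BinaryHeap.label i I.val) ∧
      -- the identification of the proper ideals with `ℤ × {+,-}^l`
      Function.Bijective
        (fun I : ProperIdeal (BinaryHeap.label : BinaryHeap l → Fin (l + 1)) =>
          BinaryHeap.coords I.val) ∧
      ∃ (β : finiteWeyl l →* Equiv.Perm (SignString l))
        (α : WeylGroup (cartanAffineC l) →* Equiv.Perm (ℤ × SignString l)),
        -- `β` is the action of `W₀` induced on the strings of the proper ideals of height `0`
        (∀ (w : finiteWeyl l)
          (I : ProperIdeal (BinaryHeap.label : BinaryHeap l → Fin (l + 1))),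
          BinaryHeap.height I.val = 0 →
            BinaryHeap.height (ρ w I).val = 0 ∧
            BinaryHeap.signString (ρ w I).val = β w (BinaryHeap.signString I.val)) ∧
        -- `β` is transitive and faithful
        (∀ s s' : SignString l, ∃ w : finiteWeyl l, β w s = s') ∧
        Function.Injective β ∧
        -- `s_i` with `1 ≤ i < l` (here `i = j + 1`) exchanges the symbols at positions `i`, `i + 1`
        (∀ (j : ℕ) (hj : j + 1 < l) (s : SignString l),
          β (finiteGen l ⟨j, by omega⟩) s = s ∘ Equiv.swap (⟨j, by omega⟩ : Fin l) ⟨j + 1, hj⟩) ∧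
        -- `s_l` alters the symbol at position `l`
        (∀ s : SignString l,
          β (finiteGen l ⟨l - 1, by omega⟩) s =
            Function.update s (⟨l - 1, by omega⟩ : Fin l) (!(s ⟨l - 1, by omega⟩))) ∧
        -- `α` is the action of `W` induced on `ℤ × {+,-}^l`; it extends `β` and is faithful
        (∀ (w : WeylGroup (cartanAffineC l))
          (I : ProperIdeal (BinaryHeap.label : BinaryHeap l → Fin (l + 1))),
          BinaryHeap.coords (ρ w I).val = α w (BinaryHeap.coords I.val)) ∧
        (∀ (w : finiteWeyl l) (t : ℤ) (s : SignString l), α w (t, s) = (t, β w s)) ∧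
        Function.Injective α ∧
        -- `s_0` alters the first symbol, and adds `1` to `t` if it was `+`, and `-1` if it was `-`
        (∀ (t : ℤ) (s : SignString l),
          α (weylGen (cartanAffineC l) 0) (t, s) =
            (if s ⟨0, by omega⟩ = true then t + 1 else t - 1,
              Function.update s (⟨0, by omega⟩ : Fin l) (!(s ⟨0, by omega⟩)))) := by
  let E := properIdealEquiv l
  have hcoords : ∀ I : ProperIdeal (BinaryHeap.label : BinaryHeap l → Fin (l + 1)),
      BinaryHeap.coords I.val = E.symm I := fun _ => rfl
  -- Defined by transport of structure, so the Coxeter relations need no check on ideals; agreement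
  -- with the heap operators is verified on generators.
  let ρ := E.permCongrHom.toMonoidHom.comp (stringAction hl)
  have hρ : ∀ w I, ρ w I = E (stringAction hl w (E.symm I)) := fun _ _ => rfl
  have hα : ∀ w I, BinaryHeap.coords (ρ w I).val = stringAction hl w (BinaryHeap.coords I.val) :=
    fun w I => by rw [hcoords, hcoords, hρ, Equiv.symm_apply_apply]
  refine ⟨finite_finiteWeyl hl,
    ⟨MulEquiv.ofBijective (finiteWeylHom hl)
      ⟨finiteWeylHom_injective hl, finiteWeylHom_surjective hl⟩, finiteWeylHom_weylGen hl⟩,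
    ρ, fun i I => ?_, E.symm.bijective, finiteStringAction hl, stringAction hl, fun w I hI => ?_,
    finiteStringAction_transitive hl, finiteStringAction_injective hl, fun j hj s => ?_,
    fun s => ?_, hα, stringAction_coe hl, stringAction_injective hl, fun t s => ?_⟩
  · obtain ⟨x, rfl⟩ := E.surjective I
    rw [hρ, Equiv.symm_apply_apply, stringAction_weylGen]
    exact (heapReflection_pathIdeal hl i x).symm
  -- At height `0` the normalizing shift is the identity.
  · have hshift : ∀ F : Set (BinaryHeap l), BinaryHeap.height F = 0 →
        BinaryHeap.coords F = (0, BinaryHeap.signString F) := by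
      intro F hF
      have : (BinaryHeap.shift (-0) : BinaryHeap l → BinaryHeap l) = id := by
        ext a <;> simp [BinaryHeap.shift]
      rw [BinaryHeap.coords, hF, this, Set.image_id]
    have h := hα w I
    rw [hshift _ hI, stringAction_coe] at h
    have h0 : BinaryHeap.height (ρ w I).val = 0 := congrArg Prod.fst h
    rw [hshift _ h0] at h
    exact ⟨h0, congrArg Prod.snd h⟩
  · rw [finiteStringAction_apply, stringAction_finiteGen,
      stringMap_mid hl (by simp) (by simpa using hj)]
    rfl
  · rw [finiteStringAction_apply, stringAction_finiteGen,
      stringMap_last hl (by simp only [Fin.succ_mk]; omega)]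
  · rw [stringAction_weylGen, stringMap_zero hl (by simp)]
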